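/- Let $\rho$ be a probability measure on a space $\Omega$ (the law of the feature parameter $\omega$), $\mu$ a probability measure on a space $\mathcal X$ (the data distribution), and $\phi:\Omega\times\mathcal X\to\mathbb R$ a jointly measurable feature map with $\mathbb E_\omega[\phi(\omega,x)^2]<\infty$ for every $x$. Put $k(x,x')=\mathbb E_{\omega}[\phi(\omega,x)\phi(\omega,x')]$. For training inputs $x_1,\dots,x_N\in\mathcal X$ and labels $y\in\mathbb R^N$ let $K=[k(x_i,x_j)]_{i,j}$ and $\lambda_{\min}=\min(1,\lambda_{\min}(K))$. For a family $\mathcal W=(\omega_1,\dots,\omega_n)$ of i.i.d. draws from $\rho$ let $\Phi_{\mathcal W}=[\phi(\omega_i,x_j)]_{j,i}\in\mathbb R^{N\times n}$ and $\hat k_{\mathcal W}(x,x')=\frac1n\sum_{i}\phi(\omega_i,x)\phi(\omega_i,x')$, and let $$h_{\mathcal W}(z)=\tfrac1n[\phi(\omega_i,z)]_i^\top\,\Phi_{\mathcal W}^\top\left(\tfrac1n\Phi_{\mathcal W}\Phi_{\mathcal W}^\top\right)^{-1}y$$ be the least-norm model of width $n$. Let $\Sigma f=\int k(x,\cdot)f(x)\,d\mu(x)$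 and $\hat\Sigma_{\mathcal W}f=\int\hat k_{\mathcal W}(x,\cdot)f(x)\,d\mu(x)$ on $L^2(\mu)$. Assume: 1. The columns of $\Phi$ are sub-Gaussian with constant $L>0$: the vector $X=(\phi(\omega,x_1),\dots,\phi(\omega,x_N))$ satisfies $\mathbb P(|X^\top v|\ge t)\le 2\exp(-t^2/L^2)$ for all $t\ge0$ and all $v\in\mathbb R^N$ with $\|v\|_2\le1$. 2. For every $\delta\in(0,1)$ there are $C(\delta)<\infty$ and $D_0(\delta)\in\mathbb N$ such that for every $n\ge \max(1,D_0(\delta))$ and $|\mathcal W|=n$, with probability at least $1-\delta$ the operators $\hat\Sigma_{\mathcal W}$ and $\Sigma$ are bounded on $L^2(\mu)$ and $\|\hat\Sigma_{\mathcal W}-\Sigma\|\le C(\delta)$. 3. For $\rho$-almost every $\omega$, $\phi(\omega,\cdot)\in L^2(\mu)$. Then there exist constants $c_1,c_2,c_3>0$, depending only on $L$, such that the following holds. Let $\delta_1\in(0,1)$. There is a constant $B\ge0$ (which may depend on $\rho,\mu,\phi,C(\cdot),D_0(\cdot),L,N,x_1,\dots,x_N,y,\delta_1$, but not on $M$, $D$,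 $\delta_3$) such that for all $M,D\ge1$ with $MD\ge D_0(\delta_1)$: write $$\kappa_1=\max\left(0,\tfrac{\lambda_{\min}}{2L^2}-\tfrac{c_1}{L^2}\left\{\sqrt{\tfrac{N}{MD}}+\tfrac{N}{MD}\right\}\right),\qquad \kappa_2=\max\left(0,\tfrac{\lambda_{\min}}{2L^2}-\tfrac{c_1}{L^2}\left\{\sqrt{\tfrac{N}{D}}+\tfrac{N}{D}\right\}\right),$$ $$\delta_2=M\,c_2e^{-c_3D\min(\kappa_2,\kappa_2^2)}+c_2e^{-c_3MD\min(\kappa_1,\kappa_1^2)}.$$ If $\kappa_2>0$ and $\delta_2<1-\delta_1$, then for every $\delta_3\in(0,1-\delta_1-\delta_2)$ and i.i.d. features $\mathcal W=(\omega_{j,i})_{j\le M,\,i\le D}$ from $\rho$, with $\mathcal W_j=(\omega_{j,i})_{i\le D}$, with probability at least $1-\delta_1-\delta_2-\delta_3$ the matrices $\Phi_{\mathcal W}\Phi_{\mathcal W}^\top$ and $\Phi_{\mathcal W_j}\Phi_{\mathcal W_j}^\top$ ($j\le M$) are all invertible and $$\left\|h_{\mathcal W}-\tfrac1M\sum_{j=1}^M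 h_{\mathcal W_j}\right\|_{L^2(\mu)}^2\le\varepsilon+\frac BD,\qquad \varepsilon=\sqrt{\tfrac1{\lambda_{\min}}\log\tfrac2{\delta_3}} .$$ -/

import Mathlib

open MeasureTheory

noncomputable section

namespace RandomFeatures

variable {Ω X ι : Type*}

/-- The limiting kernel `k(x, x') = E_ω[φ(ω, x) φ(ω, x')]`, where `ω` has law `ρ`. -/
def kernel [MeasurableSpace Ω] (ρ : Measure Ω) (φ : Ω → X → ℝ) (x x' : X) : ℝ :=
  ∫ ω, φ ω x * φ ω x' ∂ρ

/-- The kernel matrix `K = [k(x_i, x_j)]` on the training inputs. -/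
def kernelMatrix [MeasurableSpace Ω] (ρ : Measure Ω) (φ : Ω → X → ℝ) {N : ℕ} (x : Fin N → X) :
    Matrix (Fin N) (Fin N) ℝ :=
  Matrix.of fun i j => kernel ρ φ (x i) (x j)

theorem kernelMatrix_isHermitian [MeasurableSpace Ω] (ρ : Measure Ω) (φ : Ω → X → ℝ) {N : ℕ}
    (x : Fin N → X) : (kernelMatrix ρ φ x).IsHermitian := by
  ext i j
  simp [kernelMatrix, kernel, mul_comm]

/-- `min(1, λ_min(K))`, with `λ_min(K)` the smallest eigenvalue of the kernel matrix. -/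
def lamMin [MeasurableSpace Ω] (ρ : Measure Ω) (φ : Ω → X → ℝ) {N : ℕ} (x : Fin N → X) : ℝ :=
  min 1 (⨅ i, (kernelMatrix_isHermitian ρ φ x).eigenvalues i)

/-- The approximate kernel `k̂(x, x') = D⁻¹ ∑ i, φ(ω_i, x) φ(ω_i, x')` of a family of `D`
features (`D` is the size of the index type `ι`). -/
def empKernel [Fintype ι] (φ : Ω → X → ℝ) (w : ι → Ω) (x x' : X) : ℝ :=
  (Fintype.card ι : ℝ)⁻¹ * ∑ i, φ (w i) x * φ (w i) x'

/-- The feature matrix `Φ`, one row for each training input, one column for each feature. -/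
def featureMatrix (φ : Ω → X → ℝ) (w : ι → Ω) {N : ℕ} (x : Fin N → X) :
    Matrix (Fin N) ι ℝ :=
  Matrix.of fun n i => φ (w i) (x n)

/-- The empirical kernel matrix `D⁻¹ Φ Φᵀ`. -/
def empKernelMatrix [Fintype ι] (φ : Ω → X → ℝ) (w : ι → Ω) {N : ℕ} (x : Fin N → X) :
    Matrix (Fin N) (Fin N) ℝ :=
  (Fintype.card ι : ℝ)⁻¹ • (featureMatrix φ w x * (featureMatrix φ w x).transpose)

/-- The least-norm weights `θ = D^(-1/2) Φᵀ (D⁻¹ Φ Φᵀ)⁻¹ y`: the minimum-norm solution of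
`D^(-1/2) Φ θ = y`, whenever `Φ Φᵀ` is invertible. -/
def leastNormWeights [Fintype ι] (φ : Ω → X → ℝ) (w : ι → Ω) {N : ℕ} (x : Fin N → X)
    (y : Fin N → ℝ) : ι → ℝ :=
  (Real.sqrt (Fintype.card ι))⁻¹ •
    Matrix.mulVec (featureMatrix φ w x).transpose (Matrix.mulVec (empKernelMatrix φ w x)⁻¹ y)

/-- The least-norm model with features `w`, as a function of the test input. -/
def leastNormModel [Fintype ι] (φ : Ω → X → ℝ) (w : ι → Ω) {N : ℕ} (x : Fin N → X)
    (y : Fin N → ℝ) (z : X) : ℝ :=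
  (Real.sqrt (Fintype.card ι))⁻¹ * ∑ i, φ (w i) z * leastNormWeights φ w x y i

/-- The ensemble of `M` least-norm models, the `j`-th one using the `D` features `w (j, ·)`. -/
def ensembleModel {M D : ℕ} (φ : Ω → X → ℝ) (w : Fin M × Fin D → Ω) {N : ℕ} (x : Fin N → X)
    (y : Fin N → ℝ) (z : X) : ℝ :=
  (M : ℝ)⁻¹ * ∑ j, leastNormModel φ (fun i => w (j, i)) x y z

/-- A column `(φ(ω, x_1), …, φ(ω, x_N))` of the feature matrix is sub-Gaussian with constant
`L`: `P(|⟨column, v⟩| ≥ t) ≤ 2 exp(-t² / L²)` for all `t ≥ 0` and all `v` with `‖v‖₂ ≤ 1`. -/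
def SubGaussianColumn [MeasurableSpace Ω] (ρ : Measure Ω) (φ : Ω → X → ℝ) {N : ℕ}
    (x : Fin N → X) (L : ℝ) : Prop :=
  ∀ v : EuclideanSpace ℝ (Fin N), ‖v‖ ≤ 1 → ∀ t : ℝ, 0 ≤ t →
    ρ.real {ω | t ≤ |∑ n, φ ω (x n) * v n|} ≤ 2 * Real.exp (-t ^ 2 / L ^ 2)

/-- `T` is the bounded operator `f ↦ ∫ κ(x, ·) f(x) dμ(x)` on `L²(μ)`. -/
def IsIntegralOperator [MeasurableSpace X] (μ : Measure X) (κ : X → X → ℝ)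
    (T : Lp ℝ 2 μ →L[ℝ] Lp ℝ 2 μ) : Prop :=
  ∀ f : Lp ℝ 2 μ, ∀ᵐ x' ∂μ,
    Integrable (fun x => κ x x' * f x) μ ∧ T f x' = ∫ x, κ x x' * f x ∂μ

/-- The integral operators with kernels `κ₁` and `κ₂` are bounded operators on `L²(μ)`, and
their difference has operator norm at most `C`. -/
def OperatorDistLE [MeasurableSpace X] (μ : Measure X) (κ₁ κ₂ : X → X → ℝ) (C : ℝ) : Prop :=
  ∃ T₁ T₂ : Lp ℝ 2 μ →L[ℝ] Lp ℝ 2 μ,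
    IsIntegralOperator μ κ₁ T₁ ∧ IsIntegralOperator μ κ₂ T₂ ∧ ‖T₁ - T₂‖ ≤ C

/-- `lam / (2 L²) - (c₁ / L²) (√(N / n) + N / n)`. -/
def margin (c₁ L lam : ℝ) (N n : ℕ) : ℝ :=
  lam / (2 * L ^ 2) - c₁ / L ^ 2 * (Real.sqrt ((N : ℝ) / n) + (N : ℝ) / n)

/-- `c₂ exp(-c₃ n min(κ, κ²))` with `κ = max(0, margin)`. -/
def tailBound (c₁ c₂ c₃ L lam : ℝ) (N n : ℕ) : ℝ :=
  c₂ * Real.exp (-c₃ * n *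
    min (max 0 (margin c₁ L lam N n)) ((max 0 (margin c₁ L lam N n)) ^ 2))

/-- The failure probability `δ₂` from covariance concentration, for the `M` ensemble members of
width `D` together with the single model of width `M D`. -/
def deltaTwo (c₁ c₂ c₃ L lam : ℝ) (M N D : ℕ) : ℝ :=
  M * tailBound c₁ c₂ c₃ L lam N D + tailBound c₁ c₂ c₃ L lam N (M * D)

end RandomFeatures

end

noncomputable section

namespace RandomFeatures

open ProbabilityTheory

/-! Put `m = lamMin / 2`, let `K̂`, `K̂_j` be the empirical kernel matrices of the large model and
of the ensemble members, and let `u = K̂⁻¹ y`, `u_j = K̂_j⁻¹ y` be the dual coefficients. The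
difference of the two predictors is a combination of the features, and its squared L² norm is at
most the norm of the empirical integral operator times `dualDiscrepancy`, the average of `(u - u_j)ᵀ
K̂_j (u - u_j)` (`eLpNorm_leastNormModel_sub_ensembleModel_le`). Off an event of probability `δ₁`
the operator norm is at most a fixed `s`.

Off an event of probability `deltaTwo`, all these matrices dominate `m` times the identity:
sub-Gaussian columns have squares with Bernstein tails, and a net argument makes this uniform over
directions (`measureReal_not_kernelLowerBound_le`). Then two bounds hold for the discrepancy. One is
deterministic, `|y|² / m` (`mul_dualDiscrepancy_le`). The other is `|y|² / m³` times the average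
squared Frobenius distance of `K̂_j` to `K` (`pow_three_mul_dualDiscrepancy_le`), whose mean is of
order `1 / D`.

The constant `B` must not depend on `δ₃`, and a threshold `δ = exp(-lamMin * t²)`, with `t = s |y|²
/ m`, arranges this. If `δ₃ ≤ δ`, the term `ε` alone exceeds the deterministic bound `t`. If `δ₃ >
δ`, Markov's inequality at the fixed level `δ` gives the `B / D` term with failure probability below
`δ₃`. -/

/-! ### Exponential moments and tails of squared sub-Gaussian variables. -/

/-- Layer-cake formula: with `a = 1 / (2 L²)` the tail of `g²` decays like `exp(-2at)`, half of
which pays for the weight `a exp(at)`; the remaining integral is 2. -/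
theorem integrable_exp_sq_of_subGaussian {Ω : Type*} [MeasurableSpace Ω] {ρ : Measure Ω}
    [IsProbabilityMeasure ρ] {g : Ω → ℝ} {L : ℝ} (hL : 0 < L) (hg : Measurable g)
    (htail : ∀ t : ℝ, 0 ≤ t → ρ.real {ω | t ≤ |g ω|} ≤ 2 * Real.exp (-t ^ 2 / L ^ 2)) :
    Integrable (fun ω => Real.exp (1 / (2 * L ^ 2) * g ω ^ 2)) ρ ∧
      ∫ ω, Real.exp (1 / (2 * L ^ 2) * g ω ^ 2) ∂ρ ≤ 3 := by
  set a : ℝ := 1 / (2 * L ^ 2) with ha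
  have hapos : 0 < a := by positivity
  have hint : ∀ b : ℝ, ∫ t in (0 : ℝ)..b, a * Real.exp (a * t) = Real.exp (a * b) - 1 := by
    intro b
    rw [intervalIntegral.integral_eq_sub_of_hasDerivAt (f := fun t => Real.exp (a * t))]
    · simp
    · intro t _
      have := ((hasDerivAt_id t).const_mul a).exp
      simpa [mul_comm] using this
    · apply Continuous.intervalIntegrable
      fun_prop
  have hlc := lintegral_comp_eq_lintegral_meas_le_mul (f := fun ω => g ω ^ 2)
    (g := fun t => a * Real.exp (a * t)) ρ (Filter.Eventually.of_forall fun ω => sq_nonneg _)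
    (hg.pow_const 2).aemeasurable
    (fun t _ => Continuous.intervalIntegrable (by fun_prop) _ _)
    (Filter.Eventually.of_forall fun t => by positivity)
  simp only [hint] at hlc
  have hexpint : ∫⁻ t in Set.Ioi (0 : ℝ), ENNReal.ofReal (2 * a * Real.exp (-a * t)) = 2 := by
    rw [← ofReal_integral_eq_lintegral_ofReal]
    · rw [integral_const_mul, integral_exp_mul_Ioi (by linarith) 0]
      have : 2 * a * (-Real.exp (-a * 0) / -a) = 2 := by
        simp; field_simp
      rw [this]; simp
    · exact (integrableOn_exp_mul_Ioi (by linarith) 0).const_mul _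
    · exact Filter.Eventually.of_forall fun t => by positivity
  have hbound : ∫⁻ ω, ENNReal.ofReal (Real.exp (a * g ω ^ 2) - 1) ∂ρ ≤ 2 := by
    rw [hlc, ← hexpint]
    apply setLIntegral_mono' measurableSet_Ioi
    intro t ht
    have ht : 0 < t := ht
    have h1 : ρ {ω | t ≤ g ω ^ 2} ≤ ENNReal.ofReal (2 * Real.exp (-t / L ^ 2)) := by
      have h2 := htail (Real.sqrt t) (Real.sqrt_nonneg t)
      rw [Real.sq_sqrt ht.le] at h2
      have hset : {ω | Real.sqrt t ≤ |g ω|} = {ω | t ≤ g ω ^ 2} := by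
        ext ω
        simp only [Set.mem_ofPred_eq]
        rw [Real.sqrt_le_left (abs_nonneg _), sq_abs]
      rw [hset] at h2
      rw [← ofReal_measureReal]
      exact ENNReal.ofReal_le_ofReal h2
    calc ρ {ω | t ≤ g ω ^ 2} * ENNReal.ofReal (a * Real.exp (a * t))
        ≤ ENNReal.ofReal (2 * Real.exp (-t / L ^ 2)) * ENNReal.ofReal (a * Real.exp (a * t)) := by
          gcongr
      _ = ENNReal.ofReal (2 * a * Real.exp (-a * t)) := by
          rw [← ENNReal.ofReal_mul (by positivity)]
          congr 1
          have : Real.exp (-a * t) = Real.exp (-t / L ^ 2) * Real.exp (a * t) := by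
            rw [← Real.exp_add]
            congr 1
            rw [ha]; field_simp; ring
          rw [this]; ring
  have hint1 : Integrable (fun ω => Real.exp (a * g ω ^ 2) - 1) ρ := by
    refine ⟨by fun_prop, ?_⟩
    rw [hasFiniteIntegral_iff_ofReal]
    · exact hbound.trans_lt (by simp)
    · refine Filter.Eventually.of_forall fun ω => ?_
      have := Real.add_one_le_exp (a * g ω ^ 2)
      have h0 : 0 ≤ a * g ω ^ 2 := by positivity
      simp only [Pi.zero_apply]; linarith
  have hint2 : Integrable (fun ω => Real.exp (a * g ω ^ 2)) ρ := by
    refine (hint1.add (integrable_const (1 : ℝ))).congr (Filter.Eventually.of_forall fun ω => ?_)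
    simp
  refine ⟨hint2, ?_⟩
  have h3 : ∫ ω, (Real.exp (a * g ω ^ 2) - 1) ∂ρ ≤ 2 := by
    rw [integral_eq_lintegral_of_nonneg_ae]
    · exact ENNReal.toReal_le_of_le_ofReal (by norm_num) (by simpa using hbound)
    · refine Filter.Eventually.of_forall fun ω => ?_
      have := Real.add_one_le_exp (a * g ω ^ 2)
      have h0 : 0 ≤ a * g ω ^ 2 := by positivity
      simp only [Pi.zero_apply]; linarith
    · fun_prop
  rw [integral_sub hint2 (integrable_const _)] at h3
  simp at h3
  linarith

theorem exp_le_one_add_add_sq_mul_exp_abs (u : ℝ) :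
    Real.exp u ≤ 1 + u + u ^ 2 * Real.exp |u| := by
  have h1 : (1 : ℝ) ≤ Real.exp |u| := Real.one_le_exp (abs_nonneg u)
  rcases le_total |u| 1 with h | h
  · have := (abs_le.mp (Real.abs_exp_sub_one_sub_id_le h)).2
    nlinarith [sq_nonneg u]
  · rcases le_total 0 u with hu | hu
    · rw [abs_of_nonneg hu] at *
      have h2 : 1 ≤ u ^ 2 := by nlinarith
      nlinarith [mul_le_mul_of_nonneg_right h2 (Real.exp_pos u).le]
    · rw [abs_of_nonpos hu] at *
      have : Real.exp u ≤ 1 := Real.exp_le_one_iff.mpr hu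
      nlinarith [sq_nonneg u]

/-- The variance proxy of the centred square of a sub-Gaussian variable with constant `L`. -/
def sqProxy (L : ℝ) : ℝ := 96 * Real.exp 2 * L ^ 4 + 4 * L ^ 2

theorem sqProxy_pos {L : ℝ} (hL : 0 < L) : 0 < sqProxy L := by
  unfold sqProxy; positivity

theorem sq_le_two_mul_exp {u : ℝ} (hu : 0 ≤ u) : u ^ 2 ≤ 2 * Real.exp u := by
  have := Real.quadratic_le_exp_of_nonneg hu
  nlinarith

theorem integrable_sq_of_integrable_exp {Ω : Type*} [MeasurableSpace Ω] {ρ : Measure Ω}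
    {g : Ω → ℝ} {a : ℝ} (ha : 0 < a) (hg : Measurable g)
    (h : Integrable (fun ω => Real.exp (a * g ω ^ 2)) ρ) : Integrable (fun ω => g ω ^ 2) ρ := by
  refine (h.const_mul (1 / a)).mono' (by fun_prop) (Filter.Eventually.of_forall fun ω => ?_)
  rw [Real.norm_of_nonneg (sq_nonneg _)]
  have := Real.add_one_le_exp (a * g ω ^ 2)
  rw [one_div, ← div_eq_inv_mul, le_div_iff₀ ha]
  linarith

/-- Second-order expansion of the exponential: the linear term vanishes by centring, and the
remainder is controlled by the moment of `exp(a g²)`. -/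
theorem mgf_sq_sub_le {Ω : Type*} [MeasurableSpace Ω] {ρ : Measure Ω}
    [IsProbabilityMeasure ρ] {g : Ω → ℝ} {L : ℝ} (hL : 0 < L) (hg : Measurable g)
    (htail : ∀ t : ℝ, 0 ≤ t → ρ.real {ω | t ≤ |g ω|} ≤ 2 * Real.exp (-t ^ 2 / L ^ 2))
    {s : ℝ} (hs : |s| ≤ 1 / (8 * L ^ 2)) :
    Integrable (fun ω => Real.exp (s * (g ω ^ 2 - ∫ ω', g ω' ^ 2 ∂ρ))) ρ ∧
      mgf (fun ω => g ω ^ 2 - ∫ ω', g ω' ^ 2 ∂ρ) ρ s ≤ Real.exp (sqProxy L * s ^ 2) := by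
  obtain ⟨hE, hE3⟩ := integrable_exp_sq_of_subGaussian hL hg htail
  set a : ℝ := 1 / (2 * L ^ 2) with ha
  have hapos : 0 < a := by positivity
  have hs' : |s| ≤ a / 4 := by
    convert hs using 1; rw [ha]; field_simp; norm_num
  have hZ := integrable_sq_of_integrable_exp hapos hg hE
  set m : ℝ := ∫ ω', g ω' ^ 2 ∂ρ with hm
  have hm0 : 0 ≤ m := integral_nonneg fun ω => sq_nonneg _
  have ham : a * m ≤ 2 := by
    have h1 : ∫ ω, (a * g ω ^ 2 + 1) ∂ρ ≤ ∫ ω, Real.exp (a * g ω ^ 2) ∂ρ :=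
      integral_mono ((hZ.const_mul a).add (integrable_const _)) hE
        fun ω => Real.add_one_le_exp _
    rw [integral_add (hZ.const_mul a) (integrable_const _), integral_const_mul] at h1
    simp at h1
    linarith
  have key : ∀ ω, Real.exp (s * (g ω ^ 2 - m)) ≤
      1 + s * (g ω ^ 2 - m) + s ^ 2 * (8 / a ^ 2 * Real.exp 2 * Real.exp (a * g ω ^ 2)) := by
    intro ω
    refine (exp_le_one_add_add_sq_mul_exp_abs _).trans (add_le_add_right ?_ _)
    set Z := g ω ^ 2
    have hZ0 : 0 ≤ Z := sq_nonneg _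
    have hY : |Z - m| ≤ Z + m := abs_le.mpr ⟨by linarith, by linarith⟩
    -- The square costs `a/2` in the exponent and the exponential factor `a/4`; the total `3a/4`
    -- stays below `a`, and the mean contributes less than 2 since `a * m ≤ 2`.
    have h1 : (Z - m) ^ 2 ≤ 4 / a ^ 2 * (2 * Real.exp (a / 2 * (Z + m))) := by
      have h2 := sq_le_two_mul_exp (u := a / 2 * (Z + m)) (by positivity)
      have h3 : (Z - m) ^ 2 ≤ (Z + m) ^ 2 := by nlinarith
      calc (Z - m) ^ 2 ≤ (Z + m) ^ 2 := h3
        _ = 4 / a ^ 2 * (a / 2 * (Z + m)) ^ 2 := by field_simp; norm_num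
        _ ≤ _ := by gcongr
    have h2 : Real.exp |s * (Z - m)| ≤ Real.exp (a / 4 * (Z + m)) := by
      apply Real.exp_le_exp.mpr
      rw [abs_mul]
      gcongr
    rw [mul_pow, mul_assoc]
    refine mul_le_mul_of_nonneg_left ?_ (sq_nonneg s)
    calc (Z - m) ^ 2 * Real.exp |s * (Z - m)|
        ≤ 4 / a ^ 2 * (2 * Real.exp (a / 2 * (Z + m))) * Real.exp (a / 4 * (Z + m)) := by gcongr
      _ = 8 / a ^ 2 * Real.exp (a / 2 * (Z + m) + a / 4 * (Z + m)) := by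
          rw [Real.exp_add]; ring
      _ ≤ 8 / a ^ 2 * Real.exp (2 + a * Z) := by
          refine mul_le_mul_of_nonneg_left (Real.exp_le_exp.mpr ?_) (by positivity)
          nlinarith [mul_nonneg hapos.le hZ0, mul_nonneg hapos.le hm0]
      _ = _ := by rw [Real.exp_add]; ring
  have hi1 : Integrable (fun ω => 1 + s * (g ω ^ 2 - m)) ρ :=
    (integrable_const _).add ((hZ.sub (integrable_const _)).const_mul s)
  have hi2 : Integrable
      (fun ω => s ^ 2 * (8 / a ^ 2 * Real.exp 2 * Real.exp (a * g ω ^ 2))) ρ :=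
    (hE.const_mul _).const_mul _
  have hi : Integrable (fun ω => Real.exp (s * (g ω ^ 2 - m))) ρ := by
    refine (hi1.add hi2).mono' (by fun_prop) (Filter.Eventually.of_forall fun ω => ?_)
    rw [Real.norm_of_nonneg (Real.exp_pos _).le]
    exact key ω
  refine ⟨hi, ?_⟩
  have h1 := integral_mono hi (hi1.add hi2) key
  have h2 : ∫ ω, (g ω ^ 2 - m) ∂ρ = 0 := by
    rw [integral_sub hZ (integrable_const _)]; simp [hm]
  simp only [Pi.add_apply] at h1
  have h0 : ∫ ω, (1 + s * (g ω ^ 2 - m)) ∂ρ = ∫ _, (1 : ℝ) ∂ρ + ∫ ω, s * (g ω ^ 2 - m) ∂ρ :=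
    integral_add (integrable_const _) ((hZ.sub (integrable_const _)).const_mul s)
  rw [integral_add hi1 hi2, h0, integral_const_mul, integral_const_mul,
    integral_const_mul, h2] at h1
  simp at h1
  refine h1.trans ?_
  have h3 : s ^ 2 * (8 / a ^ 2 * Real.exp 2 * ∫ ω, Real.exp (a * g ω ^ 2) ∂ρ) ≤
      s ^ 2 * (8 / a ^ 2 * Real.exp 2 * 3) := by gcongr
  -- This is the source of the constant 96 in `sqProxy`: `8 * 4 * 3`, as `1 / a² = 4 L⁴`.
  have h4 : 8 / a ^ 2 * Real.exp 2 * 3 ≤ sqProxy L := by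
    unfold sqProxy
    have : 8 / a ^ 2 * Real.exp 2 * 3 = 96 * Real.exp 2 * L ^ 4 := by rw [ha]; field_simp; norm_num
    rw [this]; nlinarith [sq_nonneg L]
  have h5 := Real.add_one_le_exp (sqProxy L * s ^ 2)
  nlinarith [mul_le_mul_of_nonneg_left h4 (sq_nonneg s)]

theorem measureReal_le_sum_sub_le {Ω ι : Type*} [MeasurableSpace Ω] [Fintype ι] {ρ : Measure Ω}
    [IsProbabilityMeasure ρ] {Y : Ω → ℝ} (hY : Measurable Y) {c s t : ℝ} (hs : 0 ≤ s)
    (hi : Integrable (fun ω => Real.exp (s * Y ω)) ρ)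
    (hmgf : mgf Y ρ s ≤ Real.exp (c * s ^ 2)) :
    (Measure.pi fun _ : ι => ρ).real {w | Fintype.card ι * t ≤ ∑ i, Y (w i)} ≤
      Real.exp (Fintype.card ι * (c * s ^ 2 - s * t)) := by
  have hind : iIndepFun (fun (i : ι) (w : ι → Ω) => Y (w i)) (Measure.pi fun _ : ι => ρ) :=
    iIndepFun_pi (μ := fun _ : ι => ρ) (X := fun _ => Y) fun _ => hY.aemeasurable
  have hmeas : ∀ i : ι, Measurable fun w : ι → Ω => Y (w i) :=
    fun i => hY.comp (measurable_pi_apply i)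
  have hcomp : ∀ i : ι, mgf (fun w : ι → Ω => Y (w i)) (Measure.pi fun _ : ι => ρ) s
      = mgf Y ρ s := by
    intro i
    have h := measurePreserving_eval (fun _ : ι => ρ) i
    unfold mgf
    exact integral_comp_eval (μ := fun _ : ι => ρ) (i := i) (f := fun ω => Real.exp (s * Y ω))
      hi.aestronglyMeasurable
  have hsum := hind.mgf_sum (t := s) hmeas Finset.univ
  have hintsum := hind.integrable_exp_mul_sum (t := s) hmeas (s := Finset.univ)
    fun i _ => (measurePreserving_eval (fun _ : ι => ρ) i).integrable_comp_of_integrable hi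
  have hch := measure_ge_le_exp_mul_mgf (X := ∑ i, fun w : ι → Ω => Y (w i))
    (μ := Measure.pi fun _ : ι => ρ) (Fintype.card ι * t) hs hintsum
  rw [hsum] at hch
  simp only [hcomp, Finset.prod_const, Finset.card_univ, Finset.sum_apply] at hch
  refine hch.trans ?_
  calc Real.exp (-s * (Fintype.card ι * t)) * mgf Y ρ s ^ Fintype.card ι
      ≤ Real.exp (-s * (Fintype.card ι * t)) * Real.exp (c * s ^ 2) ^ Fintype.card ι := by
        gcongr; exact mgf_nonneg
    _ = _ := by
        rw [← Real.exp_nat_mul, ← Real.exp_add]; congr 1; ring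

theorem measureReal_le_abs_sum_sq_sub_le {Ω ι : Type*} [MeasurableSpace Ω] [Fintype ι]
    {ρ : Measure Ω} [IsProbabilityMeasure ρ] {g : Ω → ℝ} {L : ℝ} (hL : 0 < L) (hg : Measurable g)
    (htail : ∀ t : ℝ, 0 ≤ t → ρ.real {ω | t ≤ |g ω|} ≤ 2 * Real.exp (-t ^ 2 / L ^ 2))
    {t : ℝ} (ht0 : 0 ≤ t) (ht1 : t ≤ 1) :
    (Measure.pi fun _ : ι => ρ).real
        {w | Fintype.card ι * t ≤ |∑ i, (g (w i) ^ 2 - ∫ ω, g ω ^ 2 ∂ρ)|} ≤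
      2 * Real.exp (-(Fintype.card ι * t ^ 2) / (4 * sqProxy L)) := by
  have hC := sqProxy_pos hL
  -- The minimiser of the Chernoff exponent. The summand `4 L²` in `sqProxy`, together with `t ≤ 1`,
  -- keeps it in the range `s ≤ 1 / (8 L²)`.
  set s : ℝ := t / (2 * sqProxy L) with hs
  have hs0 : 0 ≤ s := by positivity
  have hs1 : |s| ≤ 1 / (8 * L ^ 2) := by
    rw [abs_of_nonneg hs0, hs]
    apply div_le_div₀ (by norm_num) ht1 (by positivity)
    unfold sqProxy
    have : 0 ≤ Real.exp 2 * L ^ 4 := by positivity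
    linarith
  have hm : Measurable fun ω => g ω ^ 2 - ∫ ω, g ω ^ 2 ∂ρ := by fun_prop
  obtain ⟨hi, hmg⟩ := mgf_sq_sub_le hL hg htail hs1
  obtain ⟨hi', hmg'⟩ := mgf_sq_sub_le hL hg htail (s := -s) (by rwa [abs_neg])
  have e1 := measureReal_le_sum_sub_le (ι := ι) (t := t) hm hs0 hi hmg
  have e2 := measureReal_le_sum_sub_le (ι := ι) (t := t) (ρ := ρ)
    (Y := fun ω => -(g ω ^ 2 - ∫ ω, g ω ^ 2 ∂ρ))
    (c := sqProxy L) hm.neg hs0 (by simpa only [mul_neg, neg_mul] using hi') (by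
      have : mgf (fun ω => -(g ω ^ 2 - ∫ ω, g ω ^ 2 ∂ρ)) ρ s
        = mgf (fun ω => (g ω ^ 2 - ∫ ω, g ω ^ 2 ∂ρ)) ρ (-s) := by
        unfold mgf; simp only [mul_neg, neg_mul]
      rw [this]; simpa only [neg_sq] using hmg')
  have hexp : (Fintype.card ι : ℝ) * (sqProxy L * s ^ 2 - s * t)
      = -(Fintype.card ι * t ^ 2) / (4 * sqProxy L) := by
    rw [hs]; field_simp; ring
  rw [hexp] at e1 e2
  have hsub : {w : ι → Ω | Fintype.card ι * t ≤ |∑ i, (g (w i) ^ 2 - ∫ ω, g ω ^ 2 ∂ρ)|} ⊆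
      {w | Fintype.card ι * t ≤ ∑ i, (g (w i) ^ 2 - ∫ ω, g ω ^ 2 ∂ρ)} ∪
      {w | Fintype.card ι * t ≤ ∑ i, -(g (w i) ^ 2 - ∫ ω, g ω ^ 2 ∂ρ)} := by
    intro w hw
    simp only [Set.mem_ofPred_eq, Set.mem_union, Finset.sum_neg_distrib] at hw ⊢
    exact le_abs.mp hw
  refine (measureReal_mono hsub).trans ((measureReal_union_le _ _).trans ?_)
  linarith

/-! ### Nets and uniform control of quadratic forms. -/

/-- A maximal 1-separated subset of the ball of radius 2, halved. The Besicovitch packing bound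
limits its size and so guarantees that a maximal one exists. -/
theorem exists_finset_half_net (E : Type*) [NormedAddCommGroup E] [NormedSpace ℝ E]
    [FiniteDimensional ℝ E] :
    ∃ s : Finset E, s.card ≤ 5 ^ Module.finrank ℝ E ∧ (∀ c ∈ s, ‖c‖ ≤ 1) ∧
      ∀ v : E, ‖v‖ ≤ 1 → ∃ c ∈ s, ‖v - c‖ ≤ 1 / 2 := by
  classical
  let P : ℕ → Prop := fun k => ∃ s : Finset E, s.card = k ∧ (∀ c ∈ s, ‖c‖ ≤ 2) ∧
    ∀ c ∈ s, ∀ d ∈ s, c ≠ d → 1 ≤ ‖c - d‖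
  obtain ⟨s, hcard, hs2, hsep⟩ : P (Nat.findGreatest P (5 ^ Module.finrank ℝ E)) :=
    Nat.findGreatest_spec (m := 0) (Nat.zero_le _) ⟨∅, by simp⟩
  have hle := Besicovitch.card_le_of_separated s hs2 hsep
  refine ⟨s.image fun c => (1 / 2 : ℝ) • c, Finset.card_image_le.trans hle, ?_, ?_⟩
  · intro c hc
    obtain ⟨d, hd, rfl⟩ := Finset.mem_image.mp hc
    rw [norm_smul, Real.norm_of_nonneg (by norm_num)]
    linarith [hs2 d hd]
  · intro v hv
    -- If `v` were far from the net, `2v` could be added to the separated set, against maximality.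
    by_contra! hcon
    have hfar : ∀ d ∈ s, 1 < ‖(2 : ℝ) • v - d‖ := by
      intro d hd
      have h := hcon _ (Finset.mem_image_of_mem _ hd)
      have : (2 : ℝ) • v - d = (2 : ℝ) • (v - (1 / 2 : ℝ) • d) := by
        rw [smul_sub, smul_smul]; norm_num
      rw [this, norm_smul, Real.norm_of_nonneg (by norm_num)]
      linarith
    have hnot : (2 : ℝ) • v ∉ s := fun h => by
      have := hfar _ h
      rw [sub_self, norm_zero] at this
      linarith
    have hP : P (s.card + 1) := by
      refine ⟨insert ((2 : ℝ) • v) s, Finset.card_insert_of_notMem hnot, ?_, ?_⟩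
      · intro c hc
        rcases Finset.mem_insert.mp hc with rfl | hc
        · rw [norm_smul, Real.norm_of_nonneg (by norm_num)]; linarith
        · exact hs2 c hc
      · intro c hc d hd hcd
        rcases Finset.mem_insert.mp hc with rfl | hc <;> rcases Finset.mem_insert.mp hd with rfl | hd
        · exact absurd rfl hcd
        · exact (hfar d hd).le
        · rw [norm_sub_rev]; exact (hfar c hc).le
        · exact hsep c hc d hd hcd
    obtain ⟨s', hs'c, hs'2, hs'sep⟩ := hP
    have hle' := Besicovitch.card_le_of_separated s' hs'2 hs'sep
    have := Nat.le_findGreatest (P := P) (n := 5 ^ Module.finrank ℝ E)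
      (m := s.card + 1) (by omega) ⟨s', hs'c, hs'2, hs'sep⟩
    omega

theorem norm_le_two_mul_of_half_net {E : Type*} [NormedAddCommGroup E] [InnerProductSpace ℝ E]
    {s : Finset E} (hs : ∀ v : E, ‖v‖ ≤ 1 → ∃ c ∈ s, ‖v - c‖ ≤ 1 / 2) {z : E} {a : ℝ}
    (h : ∀ u ∈ s, |inner ℝ u z| ≤ a) : ‖z‖ ≤ 2 * a := by
  rcases eq_or_ne z 0 with rfl | hz
  · obtain ⟨c, hc, -⟩ := hs 0 (by simp)
    have := h c hc
    simp only [norm_zero]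
    linarith [abs_nonneg (inner ℝ c (0 : E))]
  · have hz' : 0 < ‖z‖ := norm_pos_iff.mpr hz
    obtain ⟨c, hc, hcz⟩ := hs (‖z‖⁻¹ • z) (by
      rw [norm_smul, norm_inv, norm_norm, inv_mul_cancel₀ hz'.ne'])
    have h1 : inner ℝ (‖z‖⁻¹ • z) z = ‖z‖ := by
      rw [real_inner_smul_left, real_inner_self_eq_norm_sq]
      field_simp
    have h2 : inner ℝ (‖z‖⁻¹ • z - c) z ≤ 1 / 2 * ‖z‖ :=
      (real_inner_le_norm _ _).trans (by gcongr)
    rw [inner_sub_left, h1] at h2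
    linarith [(abs_le.mp (h c hc)).2]

theorem opNorm_le_four_mul_of_half_net {E : Type*} [NormedAddCommGroup E]
    [InnerProductSpace ℝ E] {s : Finset E} (hs : ∀ v : E, ‖v‖ ≤ 1 → ∃ c ∈ s, ‖v - c‖ ≤ 1 / 2)
    {T : E →L[ℝ] E} {a : ℝ} (h : ∀ u ∈ s, ∀ v ∈ s, |inner ℝ u (T v)| ≤ a) : ‖T‖ ≤ 4 * a := by
  have h1 : ∀ v ∈ s, ‖T v‖ ≤ 2 * a := fun v hv =>
    norm_le_two_mul_of_half_net hs fun u hu => h u hu v hv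
  have ha : 0 ≤ a := by
    obtain ⟨c, hc, -⟩ := hs 0 (by simp)
    exact (abs_nonneg _).trans (h c hc c hc)
  have h2 : ‖T‖ ≤ 2 * a + ‖T‖ / 2 := by
    refine T.opNorm_le_of_unit_norm (by positivity) fun v hv => ?_
    obtain ⟨c, hc, hcv⟩ := hs v hv.le
    calc ‖T v‖ = ‖T c + T (v - c)‖ := by rw [map_sub]; congr 1; abel
      _ ≤ ‖T c‖ + ‖T (v - c)‖ := norm_add_le _ _
      _ ≤ 2 * a + ‖T‖ * (1 / 2) := by
          gcongr
          · exact h1 c hc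
          · exact (T.le_opNorm _).trans (by gcongr)
      _ = _ := by ring
  linarith

/-- Polarisation reduces the bilinear form on net pairs to quadratic values at `(u ± v) / 2`, so
that only squares of single linear forms need tail bounds. These vectors stay in the unit ball when
the net does. -/
theorem abs_quadratic_le_of_half_net {N : ℕ} {s : Finset (EuclideanSpace ℝ (Fin N))}
    (hs : ∀ v : EuclideanSpace ℝ (Fin N), ‖v‖ ≤ 1 → ∃ c ∈ s, ‖v - c‖ ≤ 1 / 2)
    {A : Matrix (Fin N) (Fin N) ℝ} (hA : A.IsSymm) {a : ℝ}
    (h : ∀ u ∈ s, ∀ v ∈ s,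
      |((1 / 2 : ℝ) • (u + v)).ofLp ⬝ᵥ A.mulVec ((1 / 2 : ℝ) • (u + v)).ofLp| ≤ a ∧
      |((1 / 2 : ℝ) • (u - v)).ofLp ⬝ᵥ A.mulVec ((1 / 2 : ℝ) • (u - v)).ofLp| ≤ a)
    (v : Fin N → ℝ) : |v ⬝ᵥ A.mulVec v| ≤ 8 * a * (v ⬝ᵥ v) := by
  have hin : ∀ u v : EuclideanSpace ℝ (Fin N),
      inner ℝ u (Matrix.toEuclideanCLM (𝕜 := ℝ) A v) = u.ofLp ⬝ᵥ A.mulVec v.ofLp := by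
    intro u v
    simp [EuclideanSpace.inner_eq_star_dotProduct, dotProduct_comm]
  have hT : ‖Matrix.toEuclideanCLM (𝕜 := ℝ) A‖ ≤ 4 * (2 * a) := by
    refine opNorm_le_four_mul_of_half_net hs fun u hu v hv => ?_
    obtain ⟨h1, h2⟩ := h u hu v hv
    rw [hin]
    have hsymm : v.ofLp ⬝ᵥ A.mulVec u.ofLp = u.ofLp ⬝ᵥ A.mulVec v.ofLp := by
      rw [Matrix.dotProduct_mulVec, ← Matrix.mulVec_transpose, hA.eq, dotProduct_comm]
    have hpol : u.ofLp ⬝ᵥ A.mulVec v.ofLp =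
        ((1 / 2 : ℝ) • (u + v)).ofLp ⬝ᵥ A.mulVec ((1 / 2 : ℝ) • (u + v)).ofLp -
        ((1 / 2 : ℝ) • (u - v)).ofLp ⬝ᵥ A.mulVec ((1 / 2 : ℝ) • (u - v)).ofLp := by
      simp only [WithLp.ofLp_smul, WithLp.ofLp_add, WithLp.ofLp_sub, Matrix.mulVec_smul,
        Matrix.mulVec_add, Matrix.mulVec_sub, smul_dotProduct, dotProduct_smul, add_dotProduct,
        sub_dotProduct, dotProduct_add, dotProduct_sub, hsymm, smul_eq_mul]
      ring
    rw [hpol]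
    refine (abs_sub _ _).trans (by linarith)
  have hq := hin (WithLp.toLp 2 v) (WithLp.toLp 2 v)
  simp only at hq
  rw [← hq]
  have hn : ‖WithLp.toLp 2 v‖ ^ 2 = v ⬝ᵥ v := by
    rw [EuclideanSpace.norm_sq_eq]
    simp [dotProduct, sq]
  calc |inner ℝ (WithLp.toLp 2 v) (Matrix.toEuclideanCLM (𝕜 := ℝ) A (WithLp.toLp 2 v))|
      ≤ ‖WithLp.toLp 2 v‖ * (‖Matrix.toEuclideanCLM (𝕜 := ℝ) A‖ * ‖WithLp.toLp 2 v‖) :=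
        (abs_real_inner_le_norm _ _).trans
          (mul_le_mul_of_nonneg_left (ContinuousLinearMap.le_opNorm _ _) (norm_nonneg _))
    _ ≤ ‖WithLp.toLp 2 v‖ * (4 * (2 * a) * ‖WithLp.toLp 2 v‖) := by gcongr
    _ = _ := by rw [← hn]; ring

/-! ### Concentration of the empirical kernel matrix. -/

theorem iInf_eigenvalues_mul_le {N : ℕ} {A : Matrix (Fin N) (Fin N) ℝ} (hA : A.IsHermitian)
    (v : Fin N → ℝ) : (⨅ i, hA.eigenvalues i) * (v ⬝ᵥ v) ≤ v ⬝ᵥ A.mulVec v := by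
  set b := hA.eigenvectorBasis
  have hdot : ∀ u v : Fin N → ℝ, inner ℝ (WithLp.toLp 2 u) (WithLp.toLp 2 v) = u ⬝ᵥ v := by
    intro u v
    simp [EuclideanSpace.inner_eq_star_dotProduct, dotProduct_comm]
  have hb : ∀ i, inner ℝ (b i) (WithLp.toLp 2 (A.mulVec v))
      = hA.eigenvalues i * inner ℝ (b i) (WithLp.toLp 2 v) := by
    intro i
    have e := hdot (b i).ofLp (A.mulVec v)
    have e' := hdot (b i).ofLp v
    simp only [WithLp.toLp_ofLp] at e e'
    rw [e, e', Matrix.dotProduct_mulVec, ← Matrix.mulVec_transpose]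
    have ht : A.transpose = A := by simpa [Matrix.IsHermitian] using hA
    rw [ht, hA.mulVec_eigenvectorBasis i]
    simp [b]
  have h1 := b.sum_inner_mul_inner (WithLp.toLp 2 v) (WithLp.toLp 2 (A.mulVec v))
  have h2 := b.sum_inner_mul_inner (WithLp.toLp 2 v) (WithLp.toLp 2 v)
  rw [hdot] at h1 h2
  rw [← h1, ← h2, Finset.mul_sum]
  refine Finset.sum_le_sum fun i _ => ?_
  rw [hb, real_inner_comm (b i)]
  have : (⨅ i, hA.eigenvalues i) ≤ hA.eigenvalues i := ciInf_le (Set.finite_range _).bddBelow i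
  nlinarith [mul_le_mul_of_nonneg_right this (mul_self_nonneg (inner ℝ (b i) (WithLp.toLp 2 v)))]

theorem lamMin_mul_le {Ω X : Type*} [MeasurableSpace Ω] (ρ : Measure Ω) (φ : Ω → X → ℝ) {N : ℕ}
    (x : Fin N → X) (v : Fin N → ℝ) :
    lamMin ρ φ x * (v ⬝ᵥ v) ≤ v ⬝ᵥ (kernelMatrix ρ φ x).mulVec v := by
  refine le_trans ?_ (iInf_eigenvalues_mul_le (kernelMatrix_isHermitian ρ φ x) v)
  have : 0 ≤ v ⬝ᵥ v := by simpa using dotProduct_star_self_nonneg v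
  exact mul_le_mul_of_nonneg_right (min_le_right _ _) this

section

variable {Ω X ι : Type*} [Fintype ι] {φ : Ω → X → ℝ} {N : ℕ} {x : Fin N → X}

theorem empKernelMatrix_apply (φ : Ω → X → ℝ) (w : ι → Ω) (x : Fin N → X) (a b : Fin N) :
    empKernelMatrix φ w x a b =
      (Fintype.card ι : ℝ)⁻¹ * ∑ i, φ (w i) (x a) * φ (w i) (x b) := by
  simp [empKernelMatrix, featureMatrix, Matrix.mul_apply]

theorem empKernelMatrix_isSymm (φ : Ω → X → ℝ) (w : ι → Ω) (x : Fin N → X) :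
    (empKernelMatrix φ w x).IsSymm := by
  ext a b
  simp [empKernelMatrix_apply, mul_comm]

theorem empKernelMatrix_mulVec (φ : Ω → X → ℝ) (w : ι → Ω) (x : Fin N → X) (v : Fin N → ℝ) :
    (empKernelMatrix φ w x).mulVec v =
      (Fintype.card ι : ℝ)⁻¹ • fun a => ∑ i, φ (w i) (x a) * ∑ n, φ (w i) (x n) * v n := by
  ext a
  simp only [Matrix.mulVec, dotProduct, empKernelMatrix_apply, Pi.smul_apply, smul_eq_mul,
    Finset.mul_sum, Finset.sum_mul]
  rw [Finset.sum_comm]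
  exact Finset.sum_congr rfl fun i _ => Finset.sum_congr rfl fun n _ => by ring

theorem dotProduct_empKernelMatrix_mulVec (φ : Ω → X → ℝ) (w : ι → Ω) (x : Fin N → X)
    (u v : Fin N → ℝ) :
    u ⬝ᵥ (empKernelMatrix φ w x).mulVec v =
      (Fintype.card ι : ℝ)⁻¹ *
        ∑ i, (∑ n, φ (w i) (x n) * u n) * ∑ n, φ (w i) (x n) * v n := by
  rw [empKernelMatrix_mulVec, dotProduct_smul, smul_eq_mul]
  congr 1
  simp only [dotProduct, Finset.mul_sum]
  rw [Finset.sum_comm]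
  refine Finset.sum_congr rfl fun i _ => ?_
  simp only [Finset.sum_mul]
  rw [Finset.sum_comm]
  exact Finset.sum_congr rfl fun n _ => Finset.sum_congr rfl fun m _ => by ring

variable [MeasurableSpace Ω] {ρ : Measure Ω}

theorem dotProduct_kernelMatrix_mulVec (hφ : ∀ z, MemLp (fun ω => φ ω z) 2 ρ) (v : Fin N → ℝ) :
    v ⬝ᵥ (kernelMatrix ρ φ x).mulVec v = ∫ ω, (∑ n, φ ω (x n) * v n) ^ 2 ∂ρ := by
  have hi : ∀ a b, Integrable (fun ω => φ ω (x a) * φ ω (x b)) ρ :=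
    fun a b => (hφ (x a)).integrable_mul (hφ (x b))
  have h : ∀ ω, (∑ n, φ ω (x n) * v n) ^ 2 =
      ∑ a, ∑ b, v a * v b * (φ ω (x a) * φ ω (x b)) := by
    intro ω
    rw [sq, Finset.sum_mul_sum]
    exact Finset.sum_congr rfl fun n _ => Finset.sum_congr rfl fun m _ => by ring
  simp_rw [h]
  rw [integral_finsetSum _ fun a _ => integrable_finsetSum _ fun b _ => (hi a b).const_mul _]
  simp only [dotProduct, Matrix.mulVec, kernelMatrix, kernel, Matrix.of_apply, Finset.mul_sum]
  refine Finset.sum_congr rfl fun a _ => ?_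
  rw [integral_finsetSum _ fun b _ => (hi a b).const_mul _]
  refine Finset.sum_congr rfl fun b _ => ?_
  rw [integral_const_mul]
  ring

theorem dotProduct_empKernelMatrix_sub_kernelMatrix (hφ : ∀ z, MemLp (fun ω => φ ω z) 2 ρ)
    [Nonempty ι] (w : ι → Ω) (v : Fin N → ℝ) :
    v ⬝ᵥ (empKernelMatrix φ w x - kernelMatrix ρ φ x).mulVec v =
      (Fintype.card ι : ℝ)⁻¹ * ∑ i, ((∑ n, φ (w i) (x n) * v n) ^ 2 -
        ∫ ω, (∑ n, φ ω (x n) * v n) ^ 2 ∂ρ) := by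
  have hc : (Fintype.card ι : ℝ) ≠ 0 := by exact_mod_cast Fintype.card_ne_zero
  rw [Matrix.sub_mulVec, dotProduct_sub, dotProduct_empKernelMatrix_mulVec,
    dotProduct_kernelMatrix_mulVec hφ, Finset.sum_sub_distrib]
  simp only [← sq, Finset.sum_const, Finset.card_univ, nsmul_eq_mul]
  field_simp

/-- Union bound over at most `25 ^ N` net pairs, two vectors for each pair and two tails for each
vector. -/
theorem measureReal_not_quadratic_close_le [IsProbabilityMeasure ρ] [Nonempty ι]
    (hmeas : ∀ z, Measurable fun ω => φ ω z) (hφ : ∀ z, MemLp (fun ω => φ ω z) 2 ρ)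
    {L : ℝ} (hL : 0 < L) (hsub : SubGaussianColumn ρ φ x L) {t : ℝ} (ht0 : 0 ≤ t) (ht1 : t ≤ 1) :
    (Measure.pi fun _ : ι => ρ).real {w | ¬ ∀ v : Fin N → ℝ,
        |v ⬝ᵥ (empKernelMatrix φ w x - kernelMatrix ρ φ x).mulVec v| ≤ 8 * t * (v ⬝ᵥ v)} ≤
      4 * 25 ^ N * Real.exp (-(Fintype.card ι * t ^ 2) / (4 * sqProxy L)) := by
  obtain ⟨s, hcard, hs1, hs⟩ := exists_finset_half_net (EuclideanSpace ℝ (Fin N))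
  rw [finrank_euclideanSpace_fin] at hcard
  set r : ℝ := Real.exp (-(Fintype.card ι * t ^ 2) / (4 * sqProxy L)) with hr
  set P := Measure.pi fun _ : ι => ρ
  let bad : EuclideanSpace ℝ (Fin N) → Set (ι → Ω) := fun v =>
    {w | Fintype.card ι * t ≤ |∑ i, ((∑ n, φ (w i) (x n) * v n) ^ 2 -
        ∫ ω, (∑ n, φ ω (x n) * v n) ^ 2 ∂ρ)|}
  have hbad : ∀ v : EuclideanSpace ℝ (Fin N), ‖v‖ ≤ 1 → P.real (bad v) ≤ 2 * r := by
    intro v hv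
    exact measureReal_le_abs_sum_sq_sub_le hL
      (Finset.measurable_sum _ fun n _ => (hmeas (x n)).mul_const _)
      (hsub v hv) ht0 ht1
  have hcpos : (0 : ℝ) < Fintype.card ι := by exact_mod_cast Fintype.card_pos
  have hsubset : {w : ι → Ω | ¬ ∀ v : Fin N → ℝ,
      |v ⬝ᵥ (empKernelMatrix φ w x - kernelMatrix ρ φ x).mulVec v| ≤ 8 * t * (v ⬝ᵥ v)} ⊆
      ⋃ p ∈ s ×ˢ s, (bad ((1 / 2 : ℝ) • (p.1 + p.2)) ∪ bad ((1 / 2 : ℝ) • (p.1 - p.2))) := by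
    intro w hw
    by_contra hcon
    apply hw
    refine abs_quadratic_le_of_half_net hs
      ((empKernelMatrix_isSymm φ w x).sub (kernelMatrix_isHermitian ρ φ x)) ?_
    intro u hu v hv
    have hlt : ∀ v : EuclideanSpace ℝ (Fin N), w ∉ bad v →
        |v.ofLp ⬝ᵥ (empKernelMatrix φ w x - kernelMatrix ρ φ x).mulVec v.ofLp| ≤ t := by
      intro v hv
      rw [dotProduct_empKernelMatrix_sub_kernelMatrix hφ, abs_mul, abs_inv,
        abs_of_pos hcpos, inv_mul_le_iff₀ hcpos]
      exact (not_le.mp hv).le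
    simp only [Set.mem_iUnion, not_exists, Set.mem_union, not_or] at hcon
    have := hcon (u, v) (Finset.mem_product.mpr ⟨hu, hv⟩)
    exact ⟨hlt _ this.1, hlt _ this.2⟩
  have hhalf : ∀ u : EuclideanSpace ℝ (Fin N), ‖u‖ ≤ 2 → ‖(1 / 2 : ℝ) • u‖ ≤ 1 := by
    intro u hu
    rw [norm_smul, Real.norm_of_nonneg (by norm_num)]; linarith
  calc _ ≤ P.real (⋃ p ∈ s ×ˢ s,
        (bad ((1 / 2 : ℝ) • (p.1 + p.2)) ∪ bad ((1 / 2 : ℝ) • (p.1 - p.2)))) :=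
        measureReal_mono hsubset (measure_ne_top _ _)
    _ ≤ ∑ p ∈ s ×ˢ s,
        P.real (bad ((1 / 2 : ℝ) • (p.1 + p.2)) ∪ bad ((1 / 2 : ℝ) • (p.1 - p.2))) :=
        measureReal_biUnion_finset_le _ _
    _ ≤ ∑ p ∈ s ×ˢ s, 4 * r := by
        refine Finset.sum_le_sum fun p hp => ?_
        obtain ⟨h1, h2⟩ := Finset.mem_product.mp hp
        have e1 := hbad _ (hhalf (p.1 + p.2)
          ((norm_add_le _ _).trans (by linarith [hs1 _ h1, hs1 _ h2])))
        have e2 := hbad _ (hhalf (p.1 - p.2)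
          ((norm_sub_le _ _).trans (by linarith [hs1 _ h1, hs1 _ h2])))
        exact (measureReal_union_le _ _).trans (by linarith)
    _ = (s.card * s.card : ℝ) * (4 * r) := by
        rw [Finset.sum_const, Finset.card_product, nsmul_eq_mul]; push_cast; ring
    _ ≤ (5 ^ N * 5 ^ N : ℝ) * (4 * r) := by
        have : (s.card : ℝ) ≤ 5 ^ N := by exact_mod_cast hcard
        gcongr
    _ = 4 * 25 ^ N * r := by
        rw [← mul_pow]; norm_num; ring

/-- The empirical kernel matrix dominates `m` times the identity. -/
def KernelLowerBound (φ : Ω → X → ℝ) (x : Fin N → X) (m : ℝ) (w : ι → Ω) : Prop :=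
  ∀ v : Fin N → ℝ, m * (v ⬝ᵥ v) ≤ v ⬝ᵥ (empKernelMatrix φ w x).mulVec v

/-- A positive margin makes `N / n` so small that the net entropy `25 ^ N` uses at most half of the
concentration exponent; `c₁` and `c₃` are tuned to this. -/
theorem measureReal_not_kernelLowerBound_le [IsProbabilityMeasure ρ] [Nonempty ι]
    (hmeas : ∀ z, Measurable fun ω => φ ω z) (hφ : ∀ z, MemLp (fun ω => φ ω z) 2 ρ)
    {L : ℝ} (hL : 0 < L) (hsub : SubGaussianColumn ρ φ x L) :
    (Measure.pi fun _ : ι => ρ).real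
        {w | ¬ KernelLowerBound φ x (lamMin ρ φ x / 2) w} ≤
      tailBound (Real.sqrt (2048 * sqProxy L)) 4 (L ^ 4 / (512 * sqProxy L)) L (lamMin ρ φ x) N
        (Fintype.card ι) := by
  have hC := sqProxy_pos hL
  set C := sqProxy L
  set lam := lamMin ρ φ x
  set n := Fintype.card ι
  have hn : 0 < (n : ℝ) := by exact_mod_cast Fintype.card_pos
  set c₁ := Real.sqrt (2048 * C) with hc₁
  have hc₁pos : 0 < c₁ := Real.sqrt_pos.mpr (by positivity)
  have hc₁sq : c₁ ^ 2 = 2048 * C := Real.sq_sqrt (by positivity)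
  unfold tailBound
  set κ := margin c₁ L lam N n with hκ
  -- Without a positive margin the claimed bound is 4, hence trivial.
  rcases le_or_gt κ 0 with hκ0 | hκ0
  · rw [max_eq_left hκ0]
    have : (Measure.pi fun _ : ι => ρ).real
        {w | ¬ KernelLowerBound φ x (lam / 2) w} ≤ 1 := measureReal_le_one
    simp only [ne_eq, OfNat.ofNat_ne_zero, not_false_eq_true, zero_pow, min_self, mul_zero,
      Real.exp_zero, mul_one]
    linarith
  rw [max_eq_right hκ0.le]
  have hN0 : (0 : ℝ) ≤ (N : ℝ) / n := by positivity
  have hsqrt0 := Real.sqrt_nonneg ((N : ℝ) / n)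
  have hkey : c₁ * Real.sqrt ((N : ℝ) / n) < lam / 2 := by
    have h1 : 0 < κ * L ^ 2 := by positivity
    have h2 : κ * L ^ 2 = lam / 2 - c₁ * (Real.sqrt ((N : ℝ) / n) + (N : ℝ) / n) := by
      rw [hκ, margin]; field_simp
    nlinarith [mul_nonneg hc₁pos.le hN0]
  have hlam : 0 < lam := by nlinarith [mul_nonneg hc₁pos.le hsqrt0]
  have hlam1 : lam ≤ 1 := min_le_left _ _
  have hκle : κ ≤ lam / (2 * L ^ 2) := by
    rw [hκ, margin]
    have : 0 ≤ c₁ / L ^ 2 * (Real.sqrt ((N : ℝ) / n) + (N : ℝ) / n) := by positivity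
    linarith
  have hNle : (N : ℝ) ≤ n * lam ^ 2 / (8192 * C) := by
    have h1 : (c₁ * Real.sqrt ((N : ℝ) / n)) ^ 2 ≤ (lam / 2) ^ 2 := by
      gcongr
    rw [mul_pow, hc₁sq, Real.sq_sqrt hN0] at h1
    rw [le_div_iff₀ (by positivity)]
    have h2 : (N : ℝ) = (N : ℝ) / n * n := by field_simp
    rw [h2]
    nlinarith
  have h25 : (25 : ℝ) ^ N ≤ Real.exp (4 * N) := by
    rw [mul_comm, Real.exp_nat_mul]
    gcongr
    have h2 : (2.7182818283 : ℝ) < Real.exp 1 := Real.exp_one_gt_d9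
    have : Real.exp 4 = Real.exp 1 ^ 4 := by rw [← Real.exp_nat_mul]; norm_num
    rw [this]
    calc (25 : ℝ) ≤ 2.7182818283 ^ 4 := by norm_num
      _ ≤ _ := by gcongr
  -- The level gives `8 * t = lam / 2`, half of the spectral gap; the cap `lam ≤ 1` ensures `t ≤ 1`.
  have hmain := measureReal_not_quadratic_close_le (ι := ι) (x := x) hmeas hφ hL hsub
    (t := lam / 16) (by positivity) (by linarith)
  have hsubset : {w : ι → Ω | ¬ KernelLowerBound φ x (lam / 2) w} ⊆ {w | ¬ ∀ v : Fin N → ℝ,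
      |v ⬝ᵥ (empKernelMatrix φ w x - kernelMatrix ρ φ x).mulVec v| ≤
        8 * (lam / 16) * (v ⬝ᵥ v)} := by
    intro w hw hcon
    refine hw fun v => ?_
    have h1 := (abs_le.mp (hcon v)).1
    have h2 := lamMin_mul_le ρ φ x v
    rw [Matrix.sub_mulVec, dotProduct_sub] at h1
    linarith
  refine (measureReal_mono hsubset).trans (hmain.trans ?_)
  calc 4 * 25 ^ N * Real.exp (-(n * (lam / 16) ^ 2) / (4 * C))
      ≤ 4 * Real.exp (4 * N) * Real.exp (-(n * (lam / 16) ^ 2) / (4 * C)) := by gcongr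
    _ = 4 * Real.exp (4 * N - n * lam ^ 2 / (1024 * C)) := by
        rw [mul_assoc, ← Real.exp_add]; congr 2; field_simp; ring
    _ ≤ 4 * Real.exp (-(L ^ 4 / (512 * C)) * n * min κ (κ ^ 2)) := by
        refine mul_le_mul_of_nonneg_left (Real.exp_le_exp.mpr ?_) (by norm_num)
        have h1 : L ^ 4 / (512 * C) * n * min κ (κ ^ 2) ≤ n * lam ^ 2 / (2048 * C) := by
          calc L ^ 4 / (512 * C) * n * min κ (κ ^ 2)
              ≤ L ^ 4 / (512 * C) * n * (lam / (2 * L ^ 2)) ^ 2 := by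
                gcongr
                exact (min_le_right _ _).trans (by gcongr)
            _ = _ := by field_simp; norm_num
        have h2 : 4 * (n * lam ^ 2 / (8192 * C)) = n * lam ^ 2 / (2048 * C) := by
          field_simp; norm_num
        have h3 : n * lam ^ 2 / (1024 * C) = 2 * (n * lam ^ 2 / (2048 * C)) := by
          field_simp; norm_num
        linarith

end

/-! ### From weights to functions in L². -/

/-- The operator is `n⁻¹ ∑ g_i ⊗ g_i`, that is `n⁻¹ S S*` for the synthesis map `S c = ∑ c_i g_i`,
so `‖S‖² = n ‖T‖`. Here this is obtained from Cauchy–Schwarz applied to `‖G‖² = ∑ c_i ⟨g_i, G⟩`. -/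
theorem eLpNorm_sum_smul_sq_le {Ω X ι : Type*} [MeasurableSpace X] [Fintype ι] [Nonempty ι]
    {μ : Measure X} {φ : Ω → X → ℝ} {w : ι → Ω} (hw : ∀ i, MemLp (φ (w i)) 2 μ)
    {T : Lp ℝ 2 μ →L[ℝ] Lp ℝ 2 μ} (hT : IsIntegralOperator μ (empKernel φ w) T) (c : ι → ℝ) :
    eLpNorm (fun z => ∑ i, c i * φ (w i) z) 2 μ ^ 2 ≤
      ENNReal.ofReal (‖T‖ * (Fintype.card ι * ∑ i, c i ^ 2)) := by
  set n : ℝ := (Fintype.card ι : ℝ) with hn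
  have hnpos : 0 < n := by rw [hn]; exact_mod_cast Fintype.card_pos
  let g : ι → Lp ℝ 2 μ := fun i => (hw i).toLp (φ (w i))
  have hg : ∀ i, g i =ᵐ[μ] φ (w i) := fun i => (hw i).coeFn_toLp
  have hsum : ∀ b : ι → ℝ, (∑ i, b i • g i : Lp ℝ 2 μ) =ᵐ[μ] fun z => ∑ i, b i * φ (w i) z := by
    intro b
    have h1 : ∀ᵐ z ∂μ, ∀ i, (b i • g i : Lp ℝ 2 μ) z = b i * φ (w i) z := by
      rw [ae_all_iff]
      intro i
      filter_upwards [Lp.coeFn_smul (b i) (g i), hg i] with z h1 h2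
      rw [h1, Pi.smul_apply, h2, smul_eq_mul]
    filter_upwards [Lp.coeFn_finsetSum Finset.univ fun i => b i • g i, h1] with z h2 h3
    rw [h2, Finset.sum_apply]
    exact Finset.sum_congr rfl fun i _ => h3 i
  have hTf : ∀ f : Lp ℝ 2 μ, T f = ∑ i, (n⁻¹ * inner ℝ (g i) f) • g i := by
    intro f
    apply Lp.ext
    refine Filter.EventuallyEq.trans ?_ (hsum _).symm
    have hin : ∀ i, Integrable (fun z => φ (w i) z * f z) μ ∧
        ∫ z, φ (w i) z * f z ∂μ = inner ℝ (g i) f := by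
      intro i
      refine ⟨(hw i).integrable_mul (Lp.memLp f), ?_⟩
      rw [L2.inner_def]
      refine integral_congr_ae ?_
      filter_upwards [hg i] with z hz
      simp [hz, mul_comm]
    filter_upwards [hT f] with z hz
    rw [hz.2]
    have h1 : ∀ x, empKernel φ w x z * f x = ∑ i, n⁻¹ * φ (w i) z * (φ (w i) x * f x) := by
      intro x
      rw [empKernel, Finset.mul_sum, Finset.sum_mul]
      exact Finset.sum_congr rfl fun i _ => by ring
    simp_rw [h1]
    rw [integral_finsetSum _ fun i _ => (hin i).1.const_mul _]
    refine Finset.sum_congr rfl fun i _ => ?_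
    rw [integral_const_mul, (hin i).2]
    ring
  set G : Lp ℝ 2 μ := ∑ i, c i • g i with hG
  have hGn : ‖G‖ ^ 2 = ∑ i, c i * inner ℝ (g i) G := by
    rw [← real_inner_self_eq_norm_sq]
    nth_rewrite 1 [hG]
    rw [sum_inner]
    simp only [real_inner_smul_left]
  have hTG : n⁻¹ * ∑ i, inner ℝ (g i) G ^ 2 ≤ ‖T‖ * ‖G‖ ^ 2 := by
    have h1 : inner ℝ (T G) G = n⁻¹ * ∑ i, inner ℝ (g i) G ^ 2 := by
      rw [hTf, sum_inner, Finset.mul_sum]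
      simp only [real_inner_smul_left]
      exact Finset.sum_congr rfl fun i _ => by ring
    rw [← h1]
    calc inner ℝ (T G) G ≤ ‖T G‖ * ‖G‖ := real_inner_le_norm _ _
      _ ≤ ‖T‖ * ‖G‖ * ‖G‖ := by gcongr; exact T.le_opNorm _
      _ = _ := by ring
  have hcs := Finset.sum_mul_sq_le_sq_mul_sq Finset.univ c fun i => inner ℝ (g i) G
  rw [← hGn] at hcs
  have hc0 : 0 ≤ ∑ i, c i ^ 2 := Finset.sum_nonneg fun i _ => sq_nonneg _
  have hfin : ‖G‖ ^ 2 ≤ ‖T‖ * (n * ∑ i, c i ^ 2) := by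
    rcases (sq_nonneg ‖G‖).eq_or_lt with h0 | h0
    · rw [← h0]; positivity
    · rw [inv_mul_le_iff₀ hnpos] at hTG
      have h2 : (‖G‖ ^ 2) * ‖G‖ ^ 2 ≤ (‖T‖ * (n * ∑ i, c i ^ 2)) * ‖G‖ ^ 2 := by
        calc (‖G‖ ^ 2) * ‖G‖ ^ 2 = (‖G‖ ^ 2) ^ 2 := by ring
          _ ≤ _ := hcs
          _ ≤ (∑ i, c i ^ 2) * (n * (‖T‖ * ‖G‖ ^ 2)) := by gcongr
          _ = _ := by ring
      exact le_of_mul_le_mul_right h2 h0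
  rw [← eLpNorm_congr_ae (hsum c), ← Lp.enorm_def, ← ofReal_norm, ← ENNReal.ofReal_pow (norm_nonneg _)]
  exact ENNReal.ofReal_le_ofReal hfin

/-! ### Linear systems with a coercive matrix. -/

section Matrix

variable {N : ℕ} {A : Matrix (Fin N) (Fin N) ℝ} {m : ℝ} {u y : Fin N → ℝ}

theorem zero_le_dotProduct_self (v : Fin N → ℝ) : 0 ≤ v ⬝ᵥ v := by
  simpa using dotProduct_star_self_nonneg v

theorem isUnit_of_mul_dotProduct_le (hm : 0 < m)
    (hA : ∀ v : Fin N → ℝ, m * (v ⬝ᵥ v) ≤ v ⬝ᵥ A.mulVec v) : IsUnit A := by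
  rw [← Matrix.mulVec_injective_iff_isUnit]
  intro v v' h
  have h0 : A.mulVec (v - v') = 0 := by rw [Matrix.mulVec_sub]; exact sub_eq_zero.mpr h
  have h1 := hA (v - v')
  rw [h0, dotProduct_zero] at h1
  have h2 : (v - v') ⬝ᵥ (v - v') = 0 :=
    le_antisymm (by nlinarith [zero_le_dotProduct_self (v - v')]) (zero_le_dotProduct_self _)
  exact sub_eq_zero.mp (dotProduct_self_eq_zero.mp h2)

theorem mulVec_inv_mulVec (hA : IsUnit A) (y : Fin N → ℝ) : A.mulVec (A⁻¹.mulVec y) = y := by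
  rw [Matrix.mulVec_mulVec, Matrix.mul_nonsing_inv _ ((Matrix.isUnit_iff_isUnit_det A).mp hA),
    Matrix.one_mulVec]

theorem mul_dotProduct_le_of_mulVec_eq (hm : 0 < m)
    (hA : ∀ v : Fin N → ℝ, m * (v ⬝ᵥ v) ≤ v ⬝ᵥ A.mulVec v) (hu : A.mulVec u = y) :
    0 ≤ u ⬝ᵥ y ∧ m * (u ⬝ᵥ y) ≤ y ⬝ᵥ y ∧ m ^ 2 * (u ⬝ᵥ u) ≤ y ⬝ᵥ y := by
  have h1 := hA u
  rw [hu] at h1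
  have huu := zero_le_dotProduct_self u
  have h0 : 0 ≤ u ⬝ᵥ y := le_trans (by positivity) h1
  have hcs : (u ⬝ᵥ y) ^ 2 ≤ (u ⬝ᵥ u) * (y ⬝ᵥ y) := by
    have := Finset.sum_mul_sq_le_sq_mul_sq Finset.univ u y
    simpa [dotProduct, sq] using this
  have h2 : m * (u ⬝ᵥ y) ≤ y ⬝ᵥ y := by
    rcases h0.eq_or_lt with h | h
    · rw [← h, mul_zero]; exact zero_le_dotProduct_self y
    · refine le_of_mul_le_mul_right ?_ h
      nlinarith [mul_le_mul_of_nonneg_right h1 (zero_le_dotProduct_self y)]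
  exact ⟨h0, h2, by nlinarith⟩

theorem dotProduct_mulVec_self_le (A : Matrix (Fin N) (Fin N) ℝ) (u : Fin N → ℝ) :
    A.mulVec u ⬝ᵥ A.mulVec u ≤ (∑ a, ∑ b, A a b ^ 2) * (u ⬝ᵥ u) := by
  rw [dotProduct, Finset.sum_mul]
  refine Finset.sum_le_sum fun a _ => ?_
  have := Finset.sum_mul_sq_le_sq_mul_sq Finset.univ (A a) u
  simpa [Matrix.mulVec, dotProduct, sq] using this

/-- Resolvent-type identity `A (u' - u) = (A - B) u'`: one factor `m` comes from inverting `A`, two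
from bounding `|u'|²`. -/
theorem mul_dotProduct_sub_le (hm : 0 < m) {B : Matrix (Fin N) (Fin N) ℝ} {u' : Fin N → ℝ}
    (hA : ∀ v : Fin N → ℝ, m * (v ⬝ᵥ v) ≤ v ⬝ᵥ A.mulVec v)
    (hB : ∀ v : Fin N → ℝ, m * (v ⬝ᵥ v) ≤ v ⬝ᵥ B.mulVec v)
    (hu : A.mulVec u = y) (hu' : B.mulVec u' = y) :
    m ^ 3 * ((u' - u) ⬝ᵥ A.mulVec (u' - u)) ≤ (∑ a, ∑ b, (A - B) a b ^ 2) * (y ⬝ᵥ y) := by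
  have hr : A.mulVec (u' - u) = (A - B).mulVec u' := by
    rw [Matrix.mulVec_sub, Matrix.sub_mulVec, hu, hu']
  obtain ⟨-, h1, -⟩ := mul_dotProduct_le_of_mulVec_eq hm hA hr
  obtain ⟨-, -, h2⟩ := mul_dotProduct_le_of_mulVec_eq hm hB hu'
  have h3 := dotProduct_mulVec_self_le (A - B) u'
  set F := ∑ a, ∑ b, (A - B) a b ^ 2
  have hF : 0 ≤ F := Finset.sum_nonneg fun a _ => Finset.sum_nonneg fun b _ => sq_nonneg _
  rw [hr]
  calc m ^ 3 * ((u' - u) ⬝ᵥ (A - B).mulVec u')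
      = m ^ 2 * (m * ((u' - u) ⬝ᵥ (A - B).mulVec u')) := by ring
    _ ≤ m ^ 2 * (F * (u' ⬝ᵥ u')) := mul_le_mul_of_nonneg_left (h1.trans h3) (by positivity)
    _ = F * (m ^ 2 * (u' ⬝ᵥ u')) := by ring
    _ ≤ _ := by gcongr

theorem dotProduct_sub_mulVec_sub (hA : A.IsSymm) {u' : Fin N → ℝ} (hu : A.mulVec u = y) :
    (u' - u) ⬝ᵥ A.mulVec (u' - u) = u' ⬝ᵥ A.mulVec u' - 2 * (u' ⬝ᵥ y) + u ⬝ᵥ y := by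
  have h : u ⬝ᵥ A.mulVec u' = u' ⬝ᵥ y := by
    rw [Matrix.dotProduct_mulVec, ← Matrix.mulVec_transpose, hA.eq, hu, dotProduct_comm]
  rw [Matrix.mulVec_sub, dotProduct_sub, sub_dotProduct, sub_dotProduct, h, hu]
  ring

end Matrix

/-! ### Two deterministic bounds on the discrepancy between the large model and the ensemble. -/

section Ensemble

variable {Ω X : Type*} {φ : Ω → X → ℝ} {M D N : ℕ} {x : Fin N → X} {y : Fin N → ℝ}
  {w : Fin M × Fin D → Ω}

theorem leastNormModel_eq_sum {ι : Type*} [Fintype ι] (φ : Ω → X → ℝ) (w : ι → Ω)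
    (x : Fin N → X) (y : Fin N → ℝ) (z : X) :
    leastNormModel φ w x y z = ∑ i, ((Fintype.card ι : ℝ)⁻¹ *
      ∑ n, φ (w i) (x n) * (empKernelMatrix φ w x)⁻¹.mulVec y n) * φ (w i) z := by
  have hs : (Real.sqrt (Fintype.card ι : ℝ))⁻¹ * (Real.sqrt (Fintype.card ι : ℝ))⁻¹ =
      (Fintype.card ι : ℝ)⁻¹ := by
    rw [← mul_inv, Real.mul_self_sqrt (Nat.cast_nonneg _)]
  rw [leastNormModel, Finset.mul_sum]
  refine Finset.sum_congr rfl fun i _ => ?_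
  have h : leastNormWeights φ w x y i = (Real.sqrt (Fintype.card ι : ℝ))⁻¹ *
      ∑ n, φ (w i) (x n) * (empKernelMatrix φ w x)⁻¹.mulVec y n := rfl
  rw [h, ← hs]
  ring

/-- The average over the ensemble of the squared `K̂_j`-norms of the differences between the dual
coefficients of the large model and of the `j`-th small model. -/
def dualDiscrepancy (φ : Ω → X → ℝ) (w : Fin M × Fin D → Ω) (x : Fin N → X) (y : Fin N → ℝ) : ℝ :=
  (M : ℝ)⁻¹ * ∑ j, ((empKernelMatrix φ w x)⁻¹.mulVec y -
      (empKernelMatrix φ (fun i => w (j, i)) x)⁻¹.mulVec y) ⬝ᵥ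
    (empKernelMatrix φ (fun i => w (j, i)) x).mulVec ((empKernelMatrix φ w x)⁻¹.mulVec y -
      (empKernelMatrix φ (fun i => w (j, i)) x)⁻¹.mulVec y)

/-- Both predictors expand in the same `M * D` features. The squared coefficient differences within
block `j` sum to a multiple of the quadratic form of that block's empirical matrix. -/
theorem eLpNorm_leastNormModel_sub_ensembleModel_le [MeasurableSpace X] {μ : Measure X}
    (hM : 1 ≤ M) (hD : 1 ≤ D) (hw : ∀ p, MemLp (φ (w p)) 2 μ)
    {T : Lp ℝ 2 μ →L[ℝ] Lp ℝ 2 μ} (hT : IsIntegralOperator μ (empKernel φ w) T) :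
    eLpNorm (fun z => leastNormModel φ w x y z - ensembleModel φ w x y z) 2 μ ^ 2 ≤
      ENNReal.ofReal (‖T‖ * dualDiscrepancy φ w x y) := by
  have : NeZero M := ⟨by omega⟩
  have : NeZero D := ⟨by omega⟩
  have hM0 : (M : ℝ) ≠ 0 := NeZero.ne _
  have hD0 : (D : ℝ) ≠ 0 := NeZero.ne _
  set u := (empKernelMatrix φ w x)⁻¹.mulVec y with hu
  let u' : Fin M → Fin N → ℝ := fun j => (empKernelMatrix φ (fun i => w (j, i)) x)⁻¹.mulVec y
  let c : Fin M × Fin D → ℝ := fun p =>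
    ((M : ℝ) * D)⁻¹ * ∑ n, φ (w p) (x n) * (u - u' p.1) n
  have hcard : (Fintype.card (Fin M × Fin D) : ℝ) = M * D := by simp
  have hfun : (fun z => leastNormModel φ w x y z - ensembleModel φ w x y z) =
      fun z => ∑ p, c p * φ (w p) z := by
    funext z
    rw [ensembleModel, leastNormModel_eq_sum, hcard]
    simp only [leastNormModel_eq_sum, Fintype.card_fin, Finset.mul_sum (Finset.univ : Finset (Fin M))]
    rw [Fintype.sum_prod_type, Fintype.sum_prod_type, ← Finset.sum_sub_distrib]
    refine Finset.sum_congr rfl fun j _ => ?_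
    rw [Finset.mul_sum, ← Finset.sum_sub_distrib]
    refine Finset.sum_congr rfl fun i _ => ?_
    simp only [c, Pi.sub_apply, mul_sub, Finset.sum_sub_distrib, mul_inv]
    ring
  rw [hfun]
  refine (eLpNorm_sum_smul_sq_le hw hT c).trans (le_of_eq ?_)
  congr 2
  rw [hcard, dualDiscrepancy, Fintype.sum_prod_type]
  have hj : ∀ j, (u - u' j) ⬝ᵥ (empKernelMatrix φ (fun i => w (j, i)) x).mulVec (u - u' j) =
      M ^ 2 * D * ∑ i, c (j, i) ^ 2 := by
    intro j
    rw [dotProduct_empKernelMatrix_mulVec, Fintype.card_fin]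
    simp only [c, mul_pow, ← Finset.mul_sum, ← sq]
    field_simp
  rw [Finset.sum_congr rfl fun j _ => hj j, ← Finset.mul_sum]
  field_simp

theorem empKernelMatrix_eq_average (φ : Ω → X → ℝ) (w : Fin M × Fin D → Ω) (x : Fin N → X) :
    empKernelMatrix φ w x =
      (M : ℝ)⁻¹ • ∑ j, empKernelMatrix φ (fun i => w (j, i)) x := by
  ext a b
  simp only [Matrix.smul_apply, Matrix.sum_apply, empKernelMatrix_apply, Fintype.card_prod,
    Fintype.card_fin, smul_eq_mul, ← Finset.mul_sum, Fintype.sum_prod_type]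
  push_cast
  rw [mul_inv]
  ring

variable {m : ℝ}

/-- Since `K̂` is the average of the `K̂_j`, the forms `uᵀ K̂_j u` average to `uᵀ y`, and the
discrepancy equals the average of `u_jᵀ y` minus the nonnegative `uᵀ y`. -/
theorem mul_dualDiscrepancy_le (hM : 1 ≤ M) (hm : 0 < m) (hw : KernelLowerBound φ x m w)
    (hwj : ∀ j, KernelLowerBound φ x m fun i => w (j, i)) :
    m * dualDiscrepancy φ w x y ≤ y ⬝ᵥ y := by
  have hM0 : (0 : ℝ) < M := by exact_mod_cast hM
  have hu := mulVec_inv_mulVec (isUnit_of_mul_dotProduct_le hm hw) y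
  have huj := fun j => mulVec_inv_mulVec (isUnit_of_mul_dotProduct_le hm (hwj j)) y
  rw [dualDiscrepancy, Finset.sum_congr rfl fun j _ =>
    dotProduct_sub_mulVec_sub (empKernelMatrix_isSymm φ _ x) (huj j)]
  set u := (empKernelMatrix φ w x)⁻¹.mulVec y
  have h0 := (mul_dotProduct_le_of_mulVec_eq hm hw hu).1
  have hj := fun j => (mul_dotProduct_le_of_mulVec_eq hm (hwj j) (huj j)).2.1
  have havg : (M : ℝ)⁻¹ * ∑ j, u ⬝ᵥ (empKernelMatrix φ (fun i => w (j, i)) x).mulVec u =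
      u ⬝ᵥ y := by
    conv_rhs => rw [← hu, empKernelMatrix_eq_average]
    rw [Matrix.smul_mulVec, dotProduct_smul, Matrix.sum_mulVec, dotProduct_sum, smul_eq_mul]
  rw [Finset.sum_add_distrib, Finset.sum_sub_distrib, mul_add, mul_sub, havg]
  simp only [Finset.sum_const, Finset.card_univ, Fintype.card_fin, nsmul_eq_mul]
  rw [inv_mul_cancel_left₀ hM0.ne']
  have hsum : m * ((M : ℝ)⁻¹ *
      ∑ j, (empKernelMatrix φ (fun i => w (j, i)) x)⁻¹.mulVec y ⬝ᵥ y) ≤ y ⬝ᵥ y := by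
    have h1 := Finset.sum_le_sum fun j (_ : j ∈ Finset.univ) => hj j
    rw [← Finset.mul_sum] at h1
    simp only [Finset.sum_const, Finset.card_univ, Fintype.card_fin, nsmul_eq_mul] at h1
    rw [mul_left_comm, inv_mul_le_iff₀ hM0]
    exact h1
  nlinarith

theorem sum_sub_average_sq_le (hM : 1 ≤ M) (f : Fin M → ℝ) (c : ℝ) :
    ∑ j, (f j - (M : ℝ)⁻¹ * ∑ k, f k) ^ 2 ≤ ∑ j, (f j - c) ^ 2 := by
  have hM0 : (0 : ℝ) < M := by exact_mod_cast hM
  set b := (M : ℝ)⁻¹ * ∑ k, f k with hb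
  have hs : ∑ j, (f j - b) = 0 := by
    rw [Finset.sum_sub_distrib]
    simp only [Finset.sum_const, Finset.card_univ, Fintype.card_fin, nsmul_eq_mul, hb]
    field_simp
    ring
  have h : ∑ j, (f j - c) ^ 2 = ∑ j, (f j - b) ^ 2 + M * (b - c) ^ 2 := by
    have h1 : ∀ j, (f j - c) ^ 2 = (f j - b) ^ 2 + (2 * (b - c) * (f j - b) + (b - c) ^ 2) :=
      fun j => by ring
    rw [Finset.sum_congr rfl fun j _ => h1 j, Finset.sum_add_distrib, Finset.sum_add_distrib,
      ← Finset.mul_sum, hs]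
    simp
  rw [h]
  have : 0 ≤ M * (b - c) ^ 2 := by positivity
  linarith

/-- The perturbation bound involves `K̂_j - K̂`; as `K̂` is the mean of the `K̂_j`, replacing it by
any fixed `K` only increases the sum of squares. -/
theorem pow_three_mul_dualDiscrepancy_le (hM : 1 ≤ M) (hm : 0 < m)
    (hw : KernelLowerBound φ x m w) (hwj : ∀ j, KernelLowerBound φ x m fun i => w (j, i))
    (K : Matrix (Fin N) (Fin N) ℝ) :
    m ^ 3 * dualDiscrepancy φ w x y ≤ ((M : ℝ)⁻¹ *
      ∑ j, ∑ a, ∑ b, (empKernelMatrix φ (fun i => w (j, i)) x a b - K a b) ^ 2) *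
        (y ⬝ᵥ y) := by
  have hu := mulVec_inv_mulVec (isUnit_of_mul_dotProduct_le hm hw) y
  have huj := fun j => mulVec_inv_mulVec (isUnit_of_mul_dotProduct_le hm (hwj j)) y
  have hj := fun j => mul_dotProduct_sub_le hm (hwj j) hw (huj j) hu
  have hF : ∑ j, ∑ a, ∑ b,
      (empKernelMatrix φ (fun i => w (j, i)) x - empKernelMatrix φ w x) a b ^ 2 ≤
      ∑ j, ∑ a, ∑ b, (empKernelMatrix φ (fun i => w (j, i)) x a b - K a b) ^ 2 := by
    have hcomm : ∀ F : Fin M → Fin N → Fin N → ℝ,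
        ∑ j, ∑ a, ∑ b, F j a b = ∑ a, ∑ b, ∑ j, F j a b := fun F => by
      rw [Finset.sum_comm]
      exact Finset.sum_congr rfl fun a _ => Finset.sum_comm
    rw [hcomm, hcomm]
    refine Finset.sum_le_sum fun a _ => Finset.sum_le_sum fun b _ => ?_
    have := sum_sub_average_sq_le hM (fun j => empKernelMatrix φ (fun i => w (j, i)) x a b) (K a b)
    simpa only [Matrix.sub_apply, empKernelMatrix_eq_average φ w x, Matrix.smul_apply,
      Matrix.sum_apply, smul_eq_mul] using this
  rw [dualDiscrepancy, mul_left_comm, mul_assoc]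
  refine mul_le_mul_of_nonneg_left ?_ (by positivity)
  rw [Finset.mul_sum]
  calc _ ≤ ∑ j, (∑ a, ∑ b,
        (empKernelMatrix φ (fun i => w (j, i)) x - empKernelMatrix φ w x) a b ^ 2) * (y ⬝ᵥ y) :=
        Finset.sum_le_sum fun j _ => hj j
    _ ≤ _ := by
        rw [← Finset.sum_mul]
        exact mul_le_mul_of_nonneg_right hF (zero_le_dotProduct_self y)

end Ensemble

/-! ### Mean square error of the blocks. -/

theorem measurePreserving_pi_precomp {Ω ι ι' : Type*} [MeasurableSpace Ω] [Fintype ι] [Fintype ι']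
    (ρ : Measure Ω) [IsProbabilityMeasure ρ] {e : ι' → ι} (he : Function.Injective e) :
    MeasurePreserving (fun (w : ι → Ω) (i : ι') => w (e i)) (Measure.pi fun _ : ι => ρ)
      (Measure.pi fun _ : ι' => ρ) := by
  refine ⟨by fun_prop, ?_⟩
  have hind : iIndepFun (fun (i : ι) (w : ι → Ω) => w i) (Measure.pi fun _ : ι => ρ) :=
    iIndepFun_pi (μ := fun _ : ι => ρ) (X := fun _ => id) fun _ => aemeasurable_id
  have h := (iIndepFun_iff_map_fun_eq_pi_map
    (fun i => (measurable_pi_apply (e i)).aemeasurable)).mp (hind.precomp he)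
  rw [h]
  congr 1
  funext i
  exact (measurePreserving_eval (fun _ : ι => ρ) (e i)).map_eq

theorem integral_average_sub_sq {Ω ι : Type*} [MeasurableSpace Ω] [Fintype ι] [Nonempty ι]
    {ρ : Measure Ω} [IsProbabilityMeasure ρ] {Z : Ω → ℝ} (hZ : MemLp Z 2 ρ) :
    Integrable (fun w : ι → Ω =>
        ((Fintype.card ι : ℝ)⁻¹ * ∑ i, Z (w i) - ∫ ω, Z ω ∂ρ) ^ 2) (Measure.pi fun _ => ρ) ∧
      ∫ w : ι → Ω, ((Fintype.card ι : ℝ)⁻¹ * ∑ i, Z (w i) - ∫ ω, Z ω ∂ρ) ^ 2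
        ∂(Measure.pi fun _ => ρ) = (Fintype.card ι : ℝ)⁻¹ * Var[Z; ρ] := by
  have hn : (Fintype.card ι : ℝ) ≠ 0 := by exact_mod_cast Fintype.card_ne_zero
  set P := Measure.pi fun _ : ι => ρ with hP
  have hev := fun i : ι => measurePreserving_eval (fun _ : ι => ρ) i
  have hZi : ∀ i : ι, MemLp (fun w : ι → Ω => Z (w i)) 2 P := fun i =>
    hZ.comp_measurePreserving (hev i)
  have hS : MemLp (fun w : ι → Ω => (Fintype.card ι : ℝ)⁻¹ * ∑ i, Z (w i)) 2 P :=
    (memLp_finsetSum Finset.univ fun i _ => hZi i).const_mul _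
  have hmean : ∫ w : ι → Ω, (Fintype.card ι : ℝ)⁻¹ * ∑ i, Z (w i) ∂P = ∫ ω, Z ω ∂ρ := by
    rw [integral_const_mul, integral_finsetSum _ fun i _ => (hZi i).integrable (by norm_num)]
    have h1 : ∀ i : ι, ∫ w : ι → Ω, Z (w i) ∂P = ∫ ω, Z ω ∂ρ := fun i =>
      integral_comp_eval (μ := fun _ : ι => ρ) (i := i) hZ.1
    simp only [h1, Finset.sum_const, Finset.card_univ, nsmul_eq_mul]
    field_simp
  refine ⟨(hS.sub (memLp_const _)).integrable_sq, ?_⟩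
  have hvar := variance_eq_integral hS.1.aemeasurable
  rw [hmean] at hvar
  rw [← hvar, variance_const_mul]
  have h2 := variance_sum_pi (μ := fun _ : ι => ρ) (X := fun _ => Z) fun _ => hZ
  have h3 : (∑ i : ι, fun w : ι → Ω => Z (w i)) = fun w => ∑ i, Z (w i) := by
    funext w; simp
  rw [h3] at h2
  rw [h2]
  simp only [Finset.sum_const, Finset.card_univ, nsmul_eq_mul]
  field_simp

section

variable {Ω X : Type*} [MeasurableSpace Ω] {ρ : Measure Ω} [IsProbabilityMeasure ρ]
  {φ : Ω → X → ℝ} {N : ℕ} {x : Fin N → X}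

theorem SubGaussianColumn.integrable_pow_four {L : ℝ} (hL : 0 < L)
    (hmeas : ∀ z, Measurable fun ω => φ ω z) (hsub : SubGaussianColumn ρ φ x L) (a : Fin N) :
    Integrable (fun ω => φ ω (x a) ^ 4) ρ := by
  have htail : ∀ t : ℝ, 0 ≤ t →
      ρ.real {ω | t ≤ |φ ω (x a)|} ≤ 2 * Real.exp (-t ^ 2 / L ^ 2) := by
    intro t ht
    have := hsub (EuclideanSpace.single a 1) (by simp) t ht
    simpa [Pi.single_apply] using this
  have hE := (integrable_exp_sq_of_subGaussian hL (hmeas (x a)) htail).1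
  refine (hE.const_mul (2 * (2 * L ^ 2) ^ 2)).mono' (by fun_prop)
    (Filter.Eventually.of_forall fun ω => ?_)
  rw [Real.norm_of_nonneg (by positivity)]
  have h := sq_le_two_mul_exp (u := 1 / (2 * L ^ 2) * φ ω (x a) ^ 2) (by positivity)
  calc φ ω (x a) ^ 4 = (2 * L ^ 2) ^ 2 * (1 / (2 * L ^ 2) * φ ω (x a) ^ 2) ^ 2 := by
        field_simp
    _ ≤ (2 * L ^ 2) ^ 2 * (2 * Real.exp (1 / (2 * L ^ 2) * φ ω (x a) ^ 2)) := by gcongr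
    _ = _ := by ring

theorem SubGaussianColumn.memLp_mul {L : ℝ} (hL : 0 < L)
    (hmeas : ∀ z, Measurable fun ω => φ ω z) (hsub : SubGaussianColumn ρ φ x L) (a b : Fin N) :
    MemLp (fun ω => φ ω (x a) * φ ω (x b)) 2 ρ := by
  rw [memLp_two_iff_integrable_sq (by fun_prop)]
  refine ((hsub.integrable_pow_four hL hmeas a).add (hsub.integrable_pow_four hL hmeas b)).mono'
    (by fun_prop) (Filter.Eventually.of_forall fun ω => ?_)
  rw [Real.norm_of_nonneg (sq_nonneg _), Pi.add_apply]
  nlinarith [sq_nonneg (φ ω (x a) ^ 2 - φ ω (x b) ^ 2), sq_nonneg (φ ω (x a) ^ 2),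
    sq_nonneg (φ ω (x b) ^ 2)]

/-- The sum of the variances of the entries of `φ(ω, x_a) φ(ω, x_b)`. -/
def entryVariance (ρ : Measure Ω) (φ : Ω → X → ℝ) (x : Fin N → X) : ℝ :=
  ∑ a, ∑ b, Var[fun ω => φ ω (x a) * φ ω (x b); ρ]

theorem entryVariance_nonneg (ρ : Measure Ω) (φ : Ω → X → ℝ) (x : Fin N → X) :
    0 ≤ entryVariance ρ φ x :=
  Finset.sum_nonneg fun _ _ => Finset.sum_nonneg fun _ _ => variance_nonneg _ _

/-- Markov's inequality: every block has expected squared error `entryVariance / D`, so the average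
over blocks has the same mean, whatever `M` is. -/
theorem measureReal_lt_average_sq_dist_le {L : ℝ} (hL : 0 < L)
    (hmeas : ∀ z, Measurable fun ω => φ ω z) (hsub : SubGaussianColumn ρ φ x L)
    {M D : ℕ} (hM : 1 ≤ M) (hD : 1 ≤ D) {b : ℝ} (hb : 0 < b) :
    (Measure.pi fun _ : Fin M × Fin D => ρ).real {w | b / D < (M : ℝ)⁻¹ * ∑ j, ∑ a, ∑ b,
        (empKernelMatrix φ (fun i => w (j, i)) x a b - kernelMatrix ρ φ x a b) ^ 2} ≤
      entryVariance ρ φ x / b := by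
  have : NeZero D := ⟨by omega⟩
  have hD0 : (0 : ℝ) < D := by exact_mod_cast hD
  have hM0 : (0 : ℝ) < M := by exact_mod_cast hM
  set P := Measure.pi fun _ : Fin M × Fin D => ρ
  have hj : ∀ (j : Fin M) (a b : Fin N), Integrable (fun w : Fin M × Fin D → Ω =>
        (empKernelMatrix φ (fun i => w (j, i)) x a b - kernelMatrix ρ φ x a b) ^ 2) P ∧
      ∫ w, (empKernelMatrix φ (fun i => w (j, i)) x a b - kernelMatrix ρ φ x a b) ^ 2 ∂P =
        (D : ℝ)⁻¹ * Var[fun ω => φ ω (x a) * φ ω (x b); ρ] := by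
    intro j a b
    have hpres := measurePreserving_pi_precomp ρ (e := fun i : Fin D => (j, i))
      (Prod.mk_right_injective j)
    obtain ⟨h1, h2⟩ := integral_average_sub_sq (ι := Fin D) (hsub.memLp_mul hL hmeas a b)
    rw [Fintype.card_fin] at h1 h2
    simp only [empKernelMatrix_apply, Fintype.card_fin, kernelMatrix, kernel, Matrix.of_apply]
    refine ⟨hpres.integrable_comp_of_integrable h1, ?_⟩
    rw [← h2, ← hpres.map_eq, integral_map hpres.measurable.aemeasurable]
    rw [hpres.map_eq]
    exact h1.1
  set V : (Fin M × Fin D → Ω) → ℝ := fun w => (M : ℝ)⁻¹ * ∑ j, ∑ a, ∑ b,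
    (empKernelMatrix φ (fun i => w (j, i)) x a b - kernelMatrix ρ φ x a b) ^ 2 with hV
  have hVint : Integrable V P := by
    refine Integrable.const_mul ?_ _
    exact integrable_finsetSum _ fun j _ => integrable_finsetSum _ fun a _ =>
      integrable_finsetSum _ fun b _ => (hj j a b).1
  have hVI : ∫ w, V w ∂P = (D : ℝ)⁻¹ * entryVariance ρ φ x := by
    rw [hV, integral_const_mul, integral_finsetSum _ fun j _ => integrable_finsetSum _ fun a _ =>
      integrable_finsetSum _ fun b _ => (hj j a b).1]
    have h1 : ∀ j, ∫ w : Fin M × Fin D → Ω, ∑ a, ∑ b,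
        (empKernelMatrix φ (fun i => w (j, i)) x a b - kernelMatrix ρ φ x a b) ^ 2 ∂P =
        (D : ℝ)⁻¹ * entryVariance ρ φ x := by
      intro j
      rw [integral_finsetSum _ fun a _ => integrable_finsetSum _ fun b _ => (hj j a b).1,
        entryVariance, Finset.mul_sum]
      refine Finset.sum_congr rfl fun a _ => ?_
      rw [integral_finsetSum _ fun b _ => (hj j a b).1, Finset.mul_sum]
      exact Finset.sum_congr rfl fun b _ => (hj j a b).2
    simp only [h1, Finset.sum_const, Finset.card_univ, Fintype.card_fin, nsmul_eq_mul]
    field_simp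
  have hV0 : ∀ w, 0 ≤ V w := fun w => by positivity
  have hmarkov := mul_meas_ge_le_integral_of_nonneg (Filter.Eventually.of_forall hV0) hVint (b / D)
  rw [hVI] at hmarkov
  have hle : P.real {w | b / D < V w} ≤ P.real {w | b / D ≤ V w} :=
    
    measureReal_mono (Set.ofPred_subset_ofPred.mpr fun w hw => hw.le) (measure_ne_top _ _)
  rw [le_div_iff₀ hb]
  refine le_of_mul_le_mul_left (a := (D : ℝ)⁻¹) ?_ (by positivity)
  calc (D : ℝ)⁻¹ * (P.real {w | b / D < V w} * b) = b / D * P.real {w | b / D < V w} := by ring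
    _ ≤ _ := (mul_le_mul_of_nonneg_left hle (by positivity)).trans hmarkov

end

/-! ### Reindexing of features and assembly of the events. -/

theorem empKernel_comp_equiv {Ω X ι ι' : Type*} [Fintype ι] [Fintype ι'] (φ : Ω → X → ℝ) (e : ι' ≃ ι)
    (w : ι → Ω) : empKernel φ (fun i => w (e i)) = empKernel φ w := by
  funext z z'
  rw [empKernel, empKernel, Fintype.card_congr e,
    Equiv.sum_comp e fun i => φ (w i) z * φ (w i) z']

theorem margin_nonpos_of_lam_nonpos {c₁ L lam : ℝ} (hc : 0 ≤ c₁) (hlam : lam ≤ 0)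
    (N n : ℕ) : margin c₁ L lam N n ≤ 0 := by
  have h1 : lam / (2 * L ^ 2) ≤ 0 := div_nonpos_of_nonpos_of_nonneg hlam (by positivity)
  have h2 : 0 ≤ c₁ / L ^ 2 * (Real.sqrt ((N : ℝ) / n) + (N : ℝ) / n) := by positivity
  unfold margin
  linarith

theorem IsIntegralOperator.unique {X : Type*} [MeasurableSpace X] {μ : Measure X} {κ : X → X → ℝ}
    {S T : Lp ℝ 2 μ →L[ℝ] Lp ℝ 2 μ} (hS : IsIntegralOperator μ κ S)
    (hT : IsIntegralOperator μ κ T) : S = T := by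
  ext1 f
  apply Lp.ext
  filter_upwards [hS f, hT f] with z h1 h2
  rw [h1.2, h2.2]

section

variable {Ω X : Type*} [MeasurableSpace Ω] {ρ : Measure Ω} [IsProbabilityMeasure ρ]

/-- An inequality suffices and needs no measurability of `s`; the operator-norm event is not known
to be measurable. -/
theorem measureReal_pi_comp_le {ι ι' : Type*} [Fintype ι] [Fintype ι'] {e : ι' → ι}
    (he : Function.Injective e) (s : Set (ι' → Ω)) :
    (Measure.pi fun _ : ι => ρ).real {w | (fun i => w (e i)) ∈ s} ≤
      (Measure.pi fun _ : ι' => ρ).real s := by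
  have h := measurePreserving_pi_precomp ρ he
  have h1 := Measure.le_map_apply (μ := Measure.pi fun _ : ι => ρ) h.measurable.aemeasurable s
  rw [h.map_eq] at h1
  exact ENNReal.toReal_mono (measure_ne_top _ _) h1

theorem measureReal_operatorDistLE_le [MeasurableSpace X] {μ : Measure X} (φ : Ω → X → ℝ)
    (M D : ℕ) (κ : X → X → ℝ) (C : ℝ) :
    (Measure.pi fun _ : Fin (M * D) => ρ).real {w | OperatorDistLE μ (empKernel φ w) κ C} ≤
      (Measure.pi fun _ : Fin M × Fin D => ρ).real
        {w | OperatorDistLE μ (empKernel φ w) κ C} := by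
  refine le_trans (le_of_eq ?_)
    (measureReal_pi_comp_le (ρ := ρ) (finProdFinEquiv (m := M) (n := D)).injective
      {w | OperatorDistLE μ (empKernel φ w) κ C})
  congr 1
  ext w
  simp only [Set.mem_ofPred_eq, empKernel_comp_equiv]

theorem ae_pi_forall {ι : Type*} [Fintype ι] {p : Ω → Prop} (h : ∀ᵐ ω ∂ρ, p ω) :
    ∀ᵐ w ∂(Measure.pi fun _ : ι => ρ), ∀ i, p (w i) :=
  ae_all_iff.mpr fun i => (measurePreserving_eval (fun _ : ι => ρ) i).quasiMeasurePreserving.ae h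

end

theorem isUnit_and_eLpNorm_sq_le {Ω X : Type*} [MeasurableSpace X] {μ : Measure X}
    {φ : Ω → X → ℝ} {N : ℕ} {x : Fin N → X} {y : Fin N → ℝ} {M D : ℕ}
    {w : Fin M × Fin D → Ω} (hM : 1 ≤ M) (hD : 1 ≤ D)
    (hw : ∀ p, MemLp (φ (w p)) 2 μ) {m s : ℝ} (hm : 0 < m) (hs : 0 ≤ s)
    (hlb : KernelLowerBound φ x m w) (hlbj : ∀ j, KernelLowerBound φ x m fun i => w (j, i))
    {T : Lp ℝ 2 μ →L[ℝ] Lp ℝ 2 μ} (hT : IsIntegralOperator μ (empKernel φ w) T) (hTs : ‖T‖ ≤ s)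
    {ε b : ℝ} (hε : 0 ≤ ε) (hb : 0 ≤ b) {K : Matrix (Fin N) (Fin N) ℝ}
    (h : s * ((y ⬝ᵥ y) / m) ≤ ε ∨
      (M : ℝ)⁻¹ * ∑ j, ∑ a, ∑ b,
        (empKernelMatrix φ (fun i => w (j, i)) x a b - K a b) ^ 2 ≤ b / D) :
    IsUnit (empKernelMatrix φ w x) ∧
      (∀ j, IsUnit (empKernelMatrix φ (fun i => w (j, i)) x)) ∧
      eLpNorm (fun z => leastNormModel φ w x y z - ensembleModel φ w x y z) 2 μ ^ 2 ≤
        ENNReal.ofReal (ε + s * ((y ⬝ᵥ y) / m ^ 3) * b / D) := by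
  refine ⟨isUnit_of_mul_dotProduct_le hm hlb, fun j => isUnit_of_mul_dotProduct_le hm (hlbj j),
    (eLpNorm_leastNormModel_sub_ensembleModel_le hM hD hw hT).trans
      (ENNReal.ofReal_le_ofReal ?_)⟩
  have hyy := zero_le_dotProduct_self y
  rcases h with h | h
  · have h1 := mul_dualDiscrepancy_le (y := y) hM hm hlb hlbj
    have h2 : dualDiscrepancy φ w x y ≤ (y ⬝ᵥ y) / m := by
      rw [le_div_iff₀ hm]; linarith
    calc ‖T‖ * dualDiscrepancy φ w x y ≤ ‖T‖ * ((y ⬝ᵥ y) / m) := by gcongr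
      _ ≤ s * ((y ⬝ᵥ y) / m) := by gcongr
      _ ≤ ε + 0 := by linarith
      _ ≤ _ := by gcongr; positivity
  · have h1 := pow_three_mul_dualDiscrepancy_le (y := y) hM hm hlb hlbj K
    have h2 : dualDiscrepancy φ w x y ≤ b / D * ((y ⬝ᵥ y) / m ^ 3) := by
      rw [mul_div_assoc', le_div_iff₀ (by positivity)]
      have := mul_le_mul_of_nonneg_right h hyy
      linarith
    calc ‖T‖ * dualDiscrepancy φ w x y ≤ ‖T‖ * (b / D * ((y ⬝ᵥ y) / m ^ 3)) := by gcongr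
      _ ≤ s * (b / D * ((y ⬝ᵥ y) / m ^ 3)) := by gcongr
      _ = 0 + s * ((y ⬝ᵥ y) / m ^ 3) * b / D := by ring
      _ ≤ _ := by gcongr

theorem one_sub_le_measureReal_of_kernelLowerBound {Ω X : Type*} [MeasurableSpace Ω]
    {ρ : Measure Ω} [IsProbabilityMeasure ρ] {φ : Ω → X → ℝ} {N : ℕ} {x : Fin N → X} {M D : ℕ}
    (hM : 1 ≤ M) (hD : 1 ≤ D)
    (hmeas : ∀ z, Measurable fun ω => φ ω z) (hφ : ∀ z, MemLp (fun ω => φ ω z) 2 ρ)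
    {L : ℝ} (hL : 0 < L) (hsub : SubGaussianColumn ρ φ x L)
    {E F G : Set (Fin M × Fin D → Ω)} {p : Ω → Prop} (hp : ∀ᵐ ω ∂ρ, p ω) {δ₁ δ₃ : ℝ}
    (hE : 1 - δ₁ ≤ (Measure.pi fun _ : Fin M × Fin D => ρ).real E)
    (hF : (Measure.pi fun _ : Fin M × Fin D => ρ).real F ≤ δ₃)
    (hG : ∀ w ∈ E, w ∉ F → (∀ i, p (w i)) → KernelLowerBound φ x (lamMin ρ φ x / 2) w →
      (∀ j, KernelLowerBound φ x (lamMin ρ φ x / 2) fun i => w (j, i)) → w ∈ G) :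
    1 - δ₁ - deltaTwo (Real.sqrt (2048 * sqProxy L)) 4 (L ^ 4 / (512 * sqProxy L)) L
        (lamMin ρ φ x) M N D - δ₃ ≤ (Measure.pi fun _ : Fin M × Fin D => ρ).real G := by
  have : NeZero M := ⟨by omega⟩
  have : NeZero D := ⟨by omega⟩
  set P := Measure.pi fun _ : Fin M × Fin D => ρ
  set m := lamMin ρ φ x / 2
  have hbad0 := measureReal_not_kernelLowerBound_le (ι := Fin M × Fin D) hmeas hφ hL hsub
  rw [Fintype.card_prod, Fintype.card_fin, Fintype.card_fin] at hbad0
  have hbadj : ∀ j : Fin M, P.real {w | ¬ KernelLowerBound φ x m fun i => w (j, i)} ≤ _ :=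
    fun j => (measureReal_pi_comp_le (ρ := ρ) (e := fun i : Fin D => (j, i))
      (Prod.mk_right_injective j) {w | ¬ KernelLowerBound φ x m w}).trans
      (measureReal_not_kernelLowerBound_le (ι := Fin D) hmeas hφ hL hsub)
  rw [Fintype.card_fin] at hbadj
  set τ := tailBound (Real.sqrt (2048 * sqProxy L)) 4 (L ^ 4 / (512 * sqProxy L)) L
    (lamMin ρ φ x) N D with hτ
  have hnull : P.real {w | ¬ ∀ i, p (w i)} = 0 := by
    rw [measureReal_def, ae_iff.mp (ae_pi_forall (ι := Fin M × Fin D) hp), ENNReal.toReal_zero]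
  have hunion : P.real (⋃ j, {w : Fin M × Fin D → Ω |
      ¬ KernelLowerBound φ x m fun i => w (j, i)}) ≤ M * τ := by
    refine (measureReal_iUnion_fintype_le _).trans
      ((Finset.sum_le_sum fun j _ => hbadj j).trans (le_of_eq ?_))
    rw [Finset.sum_const, Finset.card_univ, Fintype.card_fin, nsmul_eq_mul]
  -- Covering `E` uses only subadditivity, which holds for nonmeasurable sets; complements are
  -- avoided.
  have hcover : E ⊆ (((G ∪ F) ∪ {w | ¬ ∀ i, p (w i)}) ∪ {w | ¬ KernelLowerBound φ x m w}) ∪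
      ⋃ j, {w : Fin M × Fin D → Ω | ¬ KernelLowerBound φ x m fun i => w (j, i)} := by
    intro w hw
    by_contra hcon
    simp only [Set.mem_union, Set.mem_iUnion, Set.mem_ofPred_eq, not_or, not_exists,
      not_not] at hcon
    obtain ⟨⟨⟨⟨h1, h2⟩, h3⟩, h4⟩, h5⟩ := hcon
    exact h1 (hG w hw h2 h3 h4 h5)
  have h0 := measureReal_mono (μ := P) hcover (measure_ne_top _ _)
  have h1 := measureReal_union_le (μ := P)
    (((G ∪ F) ∪ {w | ¬ ∀ i, p (w i)}) ∪ {w | ¬ KernelLowerBound φ x m w})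
    (⋃ j, {w : Fin M × Fin D → Ω | ¬ KernelLowerBound φ x m fun i => w (j, i)})
  have h2 := measureReal_union_le (μ := P)
    ((G ∪ F) ∪ {w | ¬ ∀ i, p (w i)}) {w | ¬ KernelLowerBound φ x m w}
  have h3 := measureReal_union_le (μ := P) (G ∪ F) {w | ¬ ∀ i, p (w i)}
  have h4 := measureReal_union_le (μ := P) G F
  rw [deltaTwo, ← hτ]
  linarith

theorem le_sqrt_of_le_exp {lam δ t : ℝ} (hlam : 0 < lam) (hδ : 0 < δ)
    (h : δ ≤ Real.exp (-(lam * t ^ 2))) : t ≤ Real.sqrt (1 / lam * Real.log (2 / δ)) := by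
  apply Real.le_sqrt_of_sq_le
  rw [one_div, le_inv_mul_iff₀ hlam, Real.le_log_iff_exp_le (by positivity), le_div_iff₀ hδ]
  calc Real.exp (lam * t ^ 2) * δ ≤ Real.exp (lam * t ^ 2) * Real.exp (-(lam * t ^ 2)) := by gcongr
    _ = 1 := by rw [← Real.exp_add, add_neg_cancel, Real.exp_zero]
    _ ≤ 2 := by norm_num

end RandomFeatures

end

/-! ### The main theorem. -/

open RandomFeatures in
theorem mainTheorem2 (L : ℝ) (hL : 0 < L) :
    ∃ c₁ c₂ c₃ : ℝ, 0 < c₁ ∧ 0 < c₂ ∧ 0 < c₃ ∧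
      ∀ (Ω X : Type*) [MeasurableSpace Ω] [MeasurableSpace X]
        (ρ : Measure Ω) [IsProbabilityMeasure ρ] (μ : Measure X) [IsProbabilityMeasure μ]
        (φ : Ω → X → ℝ) (C : ℝ → ℝ) (D₀ : ℝ → ℕ),
        Measurable (Function.uncurry φ) →
        (∀ z, MemLp (fun ω => φ ω z) 2 ρ) →
        (∀ᵐ ω ∂ρ, MemLp (φ ω) 2 μ) →
        (∀ δ : ℝ, 0 < δ → δ < 1 → ∀ D : ℕ, 1 ≤ D → D₀ δ ≤ D →
          1 - δ ≤ (Measure.pi fun _ : Fin D => ρ).real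
            {w | RandomFeatures.OperatorDistLE μ (RandomFeatures.empKernel φ w)
              (RandomFeatures.kernel ρ φ) (C δ)}) →
        ∀ (N : ℕ) (x : Fin N → X) (y : Fin N → ℝ),
          RandomFeatures.SubGaussianColumn ρ φ x L →
          ∀ δ₁ : ℝ, 0 < δ₁ → δ₁ < 1 →
            ∃ B : ℝ, 0 ≤ B ∧ ∀ M D : ℕ, 1 ≤ M → 1 ≤ D → D₀ δ₁ ≤ M * D →
              0 < RandomFeatures.margin c₁ L (RandomFeatures.lamMin ρ φ x) N D →
              RandomFeatures.deltaTwo c₁ c₂ c₃ L (RandomFeatures.lamMin ρ φ x) M N D < 1 - δ₁ →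
              ∀ δ₃ : ℝ, 0 < δ₃ →
                δ₃ < 1 - δ₁ -
                  RandomFeatures.deltaTwo c₁ c₂ c₃ L (RandomFeatures.lamMin ρ φ x) M N D →
                1 - δ₁ - RandomFeatures.deltaTwo c₁ c₂ c₃ L (RandomFeatures.lamMin ρ φ x) M N D
                    - δ₃ ≤
                  (Measure.pi fun _ : Fin M × Fin D => ρ).real
                    {w | IsUnit (RandomFeatures.empKernelMatrix φ w x) ∧
                      (∀ j, IsUnit (RandomFeatures.empKernelMatrix φ (fun i => w (j, i)) x)) ∧
                      eLpNorm (fun z => RandomFeatures.leastNormModel φ w x y z -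
                          RandomFeatures.ensembleModel φ w x y z) 2 μ ^ 2 ≤
                        ENNReal.ofReal
                          (Real.sqrt (1 / RandomFeatures.lamMin ρ φ x * Real.log (2 / δ₃)) +
                            B / D)} := by
  have hC := sqProxy_pos hL
  refine ⟨Real.sqrt (2048 * sqProxy L), 4, L ^ 4 / (512 * sqProxy L),
    Real.sqrt_pos.mpr (by positivity), by norm_num, by positivity, ?_⟩
  intro Ω X _ _ ρ _ μ _ φ C D₀ hφm hφ hφμ hop N x y hsub δ₁ hδ₁ hδ₁'
  have hmeas : ∀ z, Measurable fun ω => φ ω z := fun z =>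
    hφm.comp (measurable_id.prodMk measurable_const)
  -- A nonpositive `lamMin` contradicts the positive margin. This covers `N = 0`, where the empty
  -- infimum is 0.
  rcases le_or_gt (lamMin ρ φ x) 0 with hlam | hlam
  · exact ⟨0, le_rfl, fun M D _ _ _ hmargin => absurd hmargin
      (not_lt.mpr (margin_nonpos_of_lam_nonpos (Real.sqrt_nonneg _) hlam N D))⟩
  have hE : ∀ M D : ℕ, 1 ≤ M → 1 ≤ D → D₀ δ₁ ≤ M * D → 1 - δ₁ ≤
      (Measure.pi fun _ : Fin M × Fin D => ρ).real
        {w | OperatorDistLE μ (empKernel φ w) (kernel ρ φ) (C δ₁)} := fun M D hM hD hD₀ =>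
    (hop δ₁ hδ₁ hδ₁' (M * D) (Nat.mul_pos hM hD) hD₀).trans
      (measureReal_operatorDistLE_le φ M D _ _)
  -- If the limiting operator is not bounded, the event in `hE` is empty, which contradicts `δ₁ <
  -- 1`.
  by_cases hT : ∃ T : Lp ℝ 2 μ →L[ℝ] Lp ℝ 2 μ, IsIntegralOperator μ (kernel ρ φ) T
  swap
  · refine ⟨0, le_rfl, fun M D hM hD hD₀ => ?_⟩
    have h := hE M D hM hD hD₀
    have hempty : {w : Fin M × Fin D → Ω |
        OperatorDistLE μ (empKernel φ w) (kernel ρ φ) (C δ₁)} = ∅ :=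
      Set.eq_empty_of_forall_notMem fun w ⟨_, T, _, hT', _⟩ => hT ⟨T, hT'⟩
    rw [hempty, measureReal_empty] at h
    linarith
  obtain ⟨T, hT⟩ := hT
  set s := ‖T‖ + |C δ₁|
  have hs : 0 ≤ s := by positivity
  set m := lamMin ρ φ x / 2
  have hm : 0 < m := by positivity
  have hyy := zero_le_dotProduct_self y
  set t := s * ((y ⬝ᵥ y) / m)
  set δ := Real.exp (-(lamMin ρ φ x * t ^ 2))
  have hδ0 : 0 < δ := Real.exp_pos _
  have hvar := entryVariance_nonneg ρ φ x
  -- Chosen so that Markov's inequality fails with probability at most `δ`; the `+ 1` keeps `b`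
  -- positive when the variance vanishes.
  set b := (entryVariance ρ φ x + 1) / δ with hb_def
  have hb : 0 < b := by positivity
  refine ⟨s * ((y ⬝ᵥ y) / m ^ 3) * b, by positivity, ?_⟩
  intro M D hM hD hD₀ _ _ δ₃ hδ₃ _
  have hfin : ∀ w ∈ {w : Fin M × Fin D → Ω |
      OperatorDistLE μ (empKernel φ w) (kernel ρ φ) (C δ₁)},
      ∃ T₁, IsIntegralOperator μ (empKernel φ w) T₁ ∧ ‖T₁‖ ≤ s := by
    rintro w ⟨T₁, T₂, h1, h2, h3⟩
    refine ⟨T₁, h1, ?_⟩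
    rw [h2.unique hT] at h3
    calc ‖T₁‖ = ‖T + (T₁ - T)‖ := by rw [add_sub_cancel]
      _ ≤ ‖T‖ + ‖T₁ - T‖ := norm_add_le _ _
      _ ≤ s := add_le_add le_rfl (h3.trans (le_abs_self _))
  -- For small `δ₃` no exceptional event is needed (`F = ∅`), because `ε` already dominates `t`.
  rcases le_or_gt δ₃ δ with hcase | hcase
  · refine one_sub_le_measureReal_of_kernelLowerBound (F := ∅) hM hD hmeas hφ hL hsub hφμ
      (hE M D hM hD hD₀) (by simpa using hδ₃.le) ?_
    intro w hw _ hp hlb hlbj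
    obtain ⟨T₁, h1, h2⟩ := hfin w hw
    exact isUnit_and_eLpNorm_sq_le (K := kernelMatrix ρ φ x) hM hD hp hm hs hlb hlbj h1 h2
      (Real.sqrt_nonneg _) hb.le (Or.inl (le_sqrt_of_le_exp hlam hδ₃ hcase))
  · have hF := measureReal_lt_average_sq_dist_le (x := x) hL hmeas hsub hM hD hb
    refine one_sub_le_measureReal_of_kernelLowerBound hM hD hmeas hφ hL hsub hφμ
      (hE M D hM hD hD₀) (hF.trans ?_) ?_
    · refine le_trans ?_ hcase.le
      rw [div_le_iff₀ hb, hb_def, mul_div_cancel₀ _ hδ0.ne']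
      linarith
    intro w hw hwF hp hlb hlbj
    obtain ⟨T₁, h1, h2⟩ := hfin w hw
    exact isUnit_and_eLpNorm_sq_le (K := kernelMatrix ρ φ x) hM hD hp hm hs hlb hlbj h1 h2
      (Real.sqrt_nonneg _) hb.le (Or.inr (not_lt.mp hwF))
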